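/- For a finite non-empty alphabet $\Sigma$, a tree over $\Sigma$ is a function $t:\{L,R\}^*\to\Sigma$; the set $T_\Sigma$ of trees carries the product topology ($\Sigma$ discrete). An alternating Muller tree automaton $\mathcal A$ over $\Sigma$ has a finite set $Q$ of states, an initial state $q_I$, a transition function $\delta$ assigning to each $(q,a)\in Q\times\Sigma$ an expression built with $\wedge,\vee$ from elements of $\{L,R\}\times Q$, and a Muller condition $\mathcal F\subseteq\mathcal P(Q)$. It accepts $t$ if Player $\exists$ has a winning strategy in the following game, which starts in $\langle\epsilon,q_I\rangle$: from $\langle u,q\rangle$ the game moves to $\langle u,\delta(q,t(u))\rangle$; from $\langle u,e_1\vee e_2\rangle$ (resp. $\langle u,e_1\wedge e_2\rangle$) Player $\exists$ (resp. $\forall$) moves to $\langle u,e_1\rangle$ or $\langle u,e_2\rangle$; from $\langle u,(d,q)\rangle$ it moves to $\langle ud,q\rangle$; and $\exists$ wins if the set of states $q$ occurring infinitely often in configurations $\langle u,q\rangle$ belongs to $\mathcal F$. Let $L(\mathcal A)$ be the set of accepted trees. $\mathcal A$ is a game automaton if every $\delta(q,a)$ has the form $(L,q_L)\vee(R,q_R)$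 or $(L,q_L)\wedge(R,q_R)$. A set of trees is regular if it is definable by a formula of S2S, the monadic second-order logic of the full binary tree, where a tree $t$ is given to the formula by the sets $\{u : t(u)=a\}$, $a\in\Sigma$. Automata are presented as finite objects by the number of states, the initial state, the table of all expressions $\delta(q,a)$, and a Boolean formula $\varphi$ over $Q$ such that $F\in\mathcal F$ iff $\varphi$ is true when exactly the variables in $F$ are true. The transition size is the number of states plus the total length of all $\delta(q,a)$; the size is the transition size plus the length of $\varphi$. **Theorem.** Let $\Sigma,\Gamma$ be finite non-empty alphabets, let $\mathcal A$ be a game automaton over $\Sigma\times\Gamma$, and let $$\forall^*L(\mathcal A)=\{t\in T_\Sigma : \{t'\in T_\Gamma : (t,t')\in L(\mathcal A)\}\text{ is comeager in } T_\Gamma\}.$$ Then $\forall^*L(\mathcal A)$ is regular. Moreover, there are a computable function and a polynomial $p$, neither depending on $\Sigma,\Gamma,\mathcal A$, such that the function maps $|\Sigma|$, $|\Gamma|$ and any presentation of such a game automaton $\mathcal A$ to a presentation of an alternating Muller tree automaton $\mathcal B$ over $\Sigma$ with $L(\mathcal B)=\forall^*L(\mathcal A)$; the size of the presentation of $\mathcal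 B$ is at most $p$ of the size of that of $\mathcal A$, and its transition size is at most $p$ of the transition size of that of $\mathcal A$. -/

import Mathlib

/-! ### Trees

The vertices of the full binary tree are the finite words over the directions, a word being a
`List Bool` (`false` is the direction left, `true` is the direction right); the root is `[]` and
the child of `u` in direction `d` is `u ++ [d]`. -/

/-- Trees over the alphabet `S`: labellings of all vertices of the full binary tree. -/
abbrev LabeledTree (S : Type) : Type := List Bool → S

/-- The tree `(t, t')` over the product alphabet. -/
def LabeledTree.pair {S G : Type} (t : LabeledTree S) (t' : LabeledTree G) :
    LabeledTree (S × G) :=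
  fun u => (t u, t' u)

/-- A set of trees is comeager if its complement is meager, in the product topology that comes
from the discrete topology on the alphabet. -/
def Comeager {G : Type} (E : Set (LabeledTree G)) : Prop :=
  letI : TopologicalSpace G := ⊥
  IsMeagre Eᶜ

/-- The category quantifier: the trees `t` for which the section of `L` at `t` is comeager. -/
def categoryQuantifier {S G : Type} (L : Set (LabeledTree (S × G))) : Set (LabeledTree S) :=
  {t | Comeager {t' : LabeledTree G | t.pair t' ∈ L}}

/-! ### Alternating automata -/

/-- Positive expressions `e ::= x | e ∧ e | e ∨ e` over `X`. -/
inductive PosExpr (X : Type) : Type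
  | atom (x : X) : PosExpr X
  | and (e₁ e₂ : PosExpr X) : PosExpr X
  | or (e₁ e₂ : PosExpr X) : PosExpr X

/-- An alternating Muller tree automaton over the alphabet `S` with states `Q`. Finiteness of `S`
and `Q` is assumed where automata are used. -/
structure AltAutomaton (S Q : Type) where
  init : Q
  trans : Q → S → PosExpr (Bool × Q)
  muller : Set (Set Q)

/-- Configurations `⟨u, q⟩` and `⟨u, e⟩` of the acceptance game. -/
inductive Config (Q : Type) : Type
  | state (u : List Bool) (q : Q) : Config Q
  | expr (u : List Bool) (e : PosExpr (Bool × Q)) : Config Q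

namespace AltAutomaton

variable {S Q : Type}

/-- `A.Step t c c'`: in the acceptance game on `t`, the game can move from `c` to `c'`. -/
def Step (A : AltAutomaton S Q) (t : LabeledTree S) : Config Q → Config Q → Prop
  | .state u q, c' => c' = .expr u (A.trans q (t u))
  | .expr u (.atom x), c' => c' = .state (u ++ [x.1]) x.2
  | .expr u (.and e₁ e₂), c' => c' = .expr u e₁ ∨ c' = .expr u e₂
  | .expr u (.or e₁ e₂), c' => c' = .expr u e₁ ∨ c' = .expr u e₂

/-- Plays of the acceptance game on `t`. -/
def IsPlay (A : AltAutomaton S Q) (t : LabeledTree S) (π : ℕ → Config Q) : Prop :=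
  π 0 = .state [] A.init ∧ ∀ n, A.Step t (π n) (π (n + 1))

/-- A strategy of the existential player resolves each of her choices (`true` for the first and
`false` for the second disjunct) depending on the sequence of all configurations visited so far,
including the current one. -/
abbrev Strategy (Q : Type) : Type := List (Config Q) → Bool

/-- The play `π` is consistent with the strategy `σ` of the existential player. -/
def Consistent (σ : Strategy Q) (π : ℕ → Config Q) : Prop :=
  ∀ n u e₁ e₂, π n = .expr u (.or e₁ e₂) →
    π (n + 1) = .expr u (bif σ ((List.range (n + 1)).map π) then e₁ else e₂)

/-- The states that occur infinitely often in configurations `⟨u, q⟩` of `π`. -/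
def infStates (π : ℕ → Config Q) : Set Q :=
  {q | ∃ᶠ n in Filter.atTop, ∃ u, π n = .state u q}

/-- The trees on which the existential player has a winning strategy in the acceptance game. -/
def language (A : AltAutomaton S Q) : Set (LabeledTree S) :=
  {t | ∃ σ : Strategy Q, ∀ π : ℕ → Config Q,
    A.IsPlay t π → Consistent σ π → infStates π ∈ A.muller}

/-- Game automata: every transition is `(L, qL) ∨ (R, qR)` or `(L, qL) ∧ (R, qR)`. -/
def IsGame (A : AltAutomaton S Q) : Prop :=
  ∀ q a, ∃ qL qR : Q,
    A.trans q a = .or (.atom (false, qL)) (.atom (true, qR)) ∨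
    A.trans q a = .and (.atom (false, qL)) (.atom (true, qR))

end AltAutomaton

/-! ### Regular languages: definability in S2S -/

/-- Formulas of S2S; the first-order and the second-order variables are named by numbers. -/
inductive S2S : Type
  | succL (x y : ℕ) : S2S
  | succR (x y : ℕ) : S2S
  | mem (x X : ℕ) : S2S
  | neg (φ : S2S) : S2S
  | or (φ ψ : S2S) : S2S
  | all₁ (x : ℕ) (φ : S2S) : S2S
  | all₂ (X : ℕ) (φ : S2S) : S2S

/-- Satisfaction in the full binary tree, under the valuations `v` and `V` of the variables. -/
def S2S.Sat : S2S → (ℕ → List Bool) → (ℕ → Set (List Bool)) → Prop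
  | .succL x y, v, _ => v y = v x ++ [false]
  | .succR x y, v, _ => v y = v x ++ [true]
  | .mem x X, v, V => v x ∈ V X
  | .neg φ, v, V => ¬ φ.Sat v V
  | .or φ ψ, v, V => φ.Sat v V ∨ ψ.Sat v V
  | .all₁ x φ, v, V => ∀ u : List Bool, φ.Sat (Function.update v x u) V
  | .all₂ X φ, v, V => ∀ U : Set (List Bool), φ.Sat v (Function.update V X U)

/-- A language of trees over a finite alphabet is regular if it is definable in S2S, where a tree
`t` is given to the formula by the sets `{u | t u = a}`, one variable `X a` for each letter `a`.
The truth value must not depend on any other variable. -/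
def IsRegularTreeLanguage {S : Type} (L : Set (LabeledTree S)) : Prop :=
  ∃ (φ : S2S) (X : S → ℕ), Function.Injective X ∧
    ∀ (t : LabeledTree S) (v : ℕ → List Bool) (V : ℕ → Set (List Bool)),
      (∀ a, V (X a) = {u | t u = a}) → (t ∈ L ↔ φ.Sat v V)

/-! ### Finite presentations of automata -/

/-- Boolean formulas over the states, used to present a Muller condition. -/
inductive MullerFormula (Q : Type) : Type
  | visit (q : Q) : MullerFormula Q
  | neg (φ : MullerFormula Q) : MullerFormula Q
  | and (φ ψ : MullerFormula Q) : MullerFormula Q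
  | or (φ ψ : MullerFormula Q) : MullerFormula Q

namespace MullerFormula

variable {Q : Type}

/-- Truth of the formula when exactly the states in `F` are visited infinitely often. -/
def Holds (F : Set Q) : MullerFormula Q → Prop
  | .visit q => q ∈ F
  | .neg φ => ¬ φ.Holds F
  | .and φ ψ => φ.Holds F ∧ ψ.Holds F
  | .or φ ψ => φ.Holds F ∨ ψ.Holds F

/-- The formula presents the given Muller condition. -/
def Presents (φ : MullerFormula Q) (𝓕 : Set (Set Q)) : Prop :=
  ∀ F : Set Q, F ∈ 𝓕 ↔ φ.Holds F

/-- Every Muller condition on a finite nonempty set of states is presented by some formula. -/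
theorem exists_presents [Finite Q] [Nonempty Q] (𝓕 : Set (Set Q)) :
    ∃ φ : MullerFormula Q, φ.Presents 𝓕 := by
  obtain ⟨q₀⟩ := ‹Nonempty Q›
  have key : ∀ (G : Set Q) (T : Set Q), ∃ φ : MullerFormula Q,
      ∀ F, φ.Holds F ↔ ∀ q ∈ T, (q ∈ F ↔ q ∈ G) := by
    intro G T
    induction T, T.toFinite using Set.Finite.induction_on with
    | empty => exact ⟨.or (.visit q₀) (.neg (.visit q₀)), fun F => by simp [Holds, em]⟩
    | @insert q T _ _ ih =>
      obtain ⟨φ, hφ⟩ := ih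
      by_cases hq : q ∈ G
      · exact ⟨.and (.visit q) φ, fun F => by simp [Holds, hφ, hq]⟩
      · exact ⟨.and (.neg (.visit q)) φ, fun F => by simp [Holds, hφ, hq]⟩
  induction 𝓕, 𝓕.toFinite using Set.Finite.induction_on with
  | empty => exact ⟨.and (.visit q₀) (.neg (.visit q₀)), fun F => by simp [Holds]⟩
  | @insert G 𝓕 _ _ ih =>
    obtain ⟨φ, hφ⟩ := ih
    obtain ⟨ψ, hψ⟩ := key G Set.univ
    refine ⟨.or ψ φ, fun F => ?_⟩
    have h : F = G ↔ ψ.Holds F := by simp [hψ, Set.ext_iff]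
    simp [Holds, ← h, ← hφ F]

/-- Symbols of a Muller formula: `inl none` is negation, `inl (some false)` is conjunction,
`inl (some true)` is disjunction, `inr i` is the state number `i`. -/
abbrev Symbol : Type := Option Bool ⊕ ℕ

/-- The formula in prefix notation, with the states replaced by their numbers. -/
def code (num : Q → ℕ) : MullerFormula Q → List Symbol
  | .visit q => [.inr (num q)]
  | .neg φ => .inl none :: φ.code num
  | .and φ ψ => .inl (some false) :: (φ.code num ++ ψ.code num)
  | .or φ ψ => .inl (some true) :: (φ.code num ++ ψ.code num)

end MullerFormula

namespace PosExpr

/-- Symbols of a transition expression: `inl false` is conjunction, `inl true` is disjunction,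
`inr (d, i)` is the atom made of the direction `d` and the state number `i`. -/
abbrev Symbol : Type := Bool ⊕ (Bool × ℕ)

/-- The expression in prefix notation, with the states replaced by their numbers. -/
def code {Q : Type} (num : Q → ℕ) : PosExpr (Bool × Q) → List Symbol
  | .atom x => [.inr (x.1, num x.2)]
  | .and e₁ e₂ => .inl false :: (e₁.code num ++ e₂.code num)
  | .or e₁ e₂ => .inl true :: (e₁.code num ++ e₂.code num)

end PosExpr

/-- Presentations of automata as finite objects: the number of states, the number of the initial
state, the table of the transitions (one row for each state, in each row one entry for each
letter), and a Boolean formula for the Muller condition. -/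
abbrev AutomatonCode : Type :=
  ℕ × ℕ × List (List (List PosExpr.Symbol)) × List MullerFormula.Symbol

/-- The number of states plus the total length of all transition expressions. -/
def AutomatonCode.graphSize (c : AutomatonCode) : ℕ :=
  c.1 + (c.2.2.1.map fun row => (row.map List.length).sum).sum

/-- The size of the whole presentation, including the formula for the Muller condition. -/
def AutomatonCode.size (c : AutomatonCode) : ℕ :=
  AutomatonCode.graphSize c + c.2.2.2.length

/-- The presentation of an automaton with letters and states numbered by `eS` and `eQ`, whose
Muller condition is presented by `φ`. -/
def AltAutomaton.code {S Q : Type} {n k : ℕ} (A : AltAutomaton S Q) (eS : S ≃ Fin n)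
    (eQ : Q ≃ Fin k) (φ : MullerFormula Q) : AutomatonCode :=
  (k, (eQ A.init : ℕ),
    (List.finRange k).map (fun i => (List.finRange n).map fun a =>
      (A.trans (eQ.symm i) (eS.symm a)).code fun q => (eQ q : ℕ)),
    φ.code fun q => (eQ q : ℕ))

/-!
The section of `L(A)` at `t` is tested by a *writing game* on `t`: the two players play the
acceptance game of `A` on `(t, t')`, while the tree `t'` is written on the fly along the branch
that is played. At each vertex one of the players is in charge. He writes the letter of `t'` and
decides who will be in charge next; the universal player starts. Whoever stays in charge forever
loses; if the players alternate in charge, the acceptance condition of `A` decides. This is a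
Banach–Mazur game played along a single branch, and it is the acceptance game of an automaton with
states `Q × Bool` (`AltAutomaton.categoryAutomaton`).

Suppose that player `P` wins the writing game. The strategy may be used on a given tree `t'` as long
as `t'` has the letters that the strategy writes when `P` is in charge. Since `A` is a game
automaton, a vertex of the tree can be reached by at most one history, once it is fixed on which
levels the opponent hands over; so the letters that the strategy wants on the tree do not conflict.
By Kőnig's lemma, the turns of `P` after the opponent has handed over on a whole level end within
finitely many levels. So it is a dense open condition that the tree contains the next turn, and on
a comeager set of trees `t'` the opponent can hand over infinitely often
(`isMeagre_diff_chain`, `WritingStrategy.Wins.isMeagre_diff`). On these trees `P` wins the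
acceptance game of `A`. If `P` is in charge first, this holds only inside of the nonempty open set given by his
first turn, and the Baire category theorem shows that the opponent's set is not comeager.

It remains to know that one of the players wins. Games are given by operators `pre P`, which map a
set of positions to the positions from which player `P` can force it in one round, and strategies
are graphs that may be nondeterministic (`StrategyGraph`). Muller games are determined by induction
on the number of colours (`winRegion_spec`): the player who wins if all colours recur wins on the
greatest set from which he can, for each colour `c`, come back to the set by way of `c` or win
without `c`. The winning regions are therefore nested fixpoints, which are definable in S2S
(`AltAutomaton.definableSet_winRegion`). So the languages of all alternating Muller automata are
regular, and the first part of the theorem follows from the construction of the second part.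
-/

/-! ### Infinite games given by monotone one-round operators -/

/-- The colours that occur infinitely often along a sequence of positions. -/
def infColors {V C : Type} (col : V → C) (x : ℕ → V) : Set C :=
  {c | ∃ᶠ i in Filter.atTop, col (x i) = c}

theorem infColors_shift {V C : Type} (col : V → C) (x : ℕ → V) (k : ℕ) :
    infColors col (fun i => x (i + k)) = infColors col x := by
  ext c
  simp only [infColors, Set.mem_ofPred_eq, Filter.frequently_atTop]
  constructor
  · intro h a
    obtain ⟨b, hb, hc⟩ := h a
    exact ⟨b + k, by omega, hc⟩
  · intro h a
    obtain ⟨b, hb, hc⟩ := h (a + k)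
    exact ⟨b - k, by omega, by rwa [Nat.sub_add_cancel (by omega)]⟩

theorem nth_succ_gap {p : ℕ → Prop} (hp : {k | p k}.Infinite) {i k : ℕ}
    (h1 : Nat.nth p i < k) (h2 : k < Nat.nth p (i + 1)) : ¬ p k := by
  classical
  intro hk
  have hc := Nat.nth_count hk
  have h3 : i < Nat.count p k := (Nat.nth_lt_nth (p := p) hp).1 (by omega)
  have h4 : Nat.count p k < i + 1 := (Nat.nth_lt_nth (p := p) hp).1 (by omega)
  omega

/-- A nondeterministic strategy with memory: nodes lie over positions, and a node is followed by
any of the nodes to which it is related by `Move`. -/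
structure StrategyGraph (V : Type) where
  Node : Type
  pos : Node → V
  Move : Node → Node → Prop
  root : Node

/-- The strategy graph `s` ensures, for the player whose one-round operator is `pre`, that a play
in the domain `D` either stays in `D` forever and has its set of infinitely recurring colours
in `W`, or leaves `D` into `T`. The operator `pre` maps a set `Z` of positions to the set of
those positions from which the player can force the next position to be in `Z`. -/
structure StrategyGraph.Wins {V C : Type} (s : StrategyGraph V) (pre : Set V → Set V)
    (col : V → C) (W : Set (Set C)) (D T : Set V) : Prop where
  mem : ∀ n, s.pos n ∈ D ∪ T
  step : ∀ n, s.pos n ∈ D → s.pos n ∈ pre (s.pos '' {n' | s.Move n n'})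
  inf : ∀ x : ℕ → s.Node, (∀ i, s.pos (x i) ∈ D) → (∀ i, s.Move (x i) (x (i + 1))) →
    infColors col (fun i => s.pos (x i)) ∈ W

/-- From the position `v`, the player with one-round operator `pre` can ensure the objective
described at `StrategyGraph.Wins`. -/
def Ensures {V C : Type} (pre : Set V → Set V) (col : V → C) (W : Set (Set C)) (D T : Set V)
    (v : V) : Prop :=
  ∃ s : StrategyGraph V, s.pos s.root = v ∧ s.Wins pre col W D T

theorem Ensures.of_mem {V C : Type} {pre : Set V → Set V} {col : V → C} {W : Set (Set C)}
    {D T : Set V} {v : V} (hT : v ∈ T) (hD : v ∉ D) : Ensures pre col W D T v :=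
  ⟨⟨Unit, fun _ => v, fun _ _ => False, ()⟩, rfl, fun _ => Or.inr hT, fun _ h => absurd h hD,
    fun _ h => absurd (h 0) hD⟩

/-- The moves of the strategy that passes through the strategies `s j` in phases: it follows
`s j` inside of the domain `D j` of the phase, and enters a strategy of the next phase at its root
after an exit. -/
inductive PhaseMove {V J : Type} (s : J → StrategyGraph V) (phase : J → ℕ) (D : ℕ → Set V) :
    (Σ j, (s j).Node) → (Σ j, (s j).Node) → Prop
  | inner {j : J} {n n' : (s j).Node} (hn : (s j).pos n ∈ D (phase j)) (h : (s j).Move n n') :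
      PhaseMove s phase D ⟨j, n⟩ ⟨j, n'⟩
  | jump {j j' : J} {n : (s j).Node} (hn : (s j).pos n ∉ D (phase j))
      (h : phase j' = phase j + 1) : PhaseMove s phase D ⟨j, n⟩ ⟨j', (s j').root⟩

/-- Composition of strategies in phases: in phase `i` the play stays in `D' i` or exits into
`T' i`; after an exit that does not yet end the play, the next position can be forced into the
set `E (i + 1)` of those positions from which the objective of the next phase can be ensured. -/
theorem Ensures.glue {V C : Type} {pre : Set V → Set V} (hpre : Monotone pre) {col : V → C}
    {W : Set (Set C)} {D T : Set V} (D' T' E : ℕ → Set V) (hD : ∀ i, D' i ⊆ D)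
    (hT : ∀ i, T' i ⊆ D ∪ T)
    (hjump : ∀ i, ∀ v ∈ T' i, v ∉ D' i → v ∈ D → v ∈ pre (E (i + 1)))
    (hE : ∀ i, ∀ v ∈ E i, Ensures pre col W (D' i) (T' i) v)
    (hinf : ∀ (x : ℕ → V) (i : ℕ) (κ : ℕ → ℕ), StrictMono κ → (∀ k, x k ∈ D) →
      (∀ j, x (κ j) ∈ T' (i + j) \ D' (i + j)) → infColors col x ∈ W)
    {v : V} (hv : v ∈ E 0) : Ensures pre col W D T v := by
  let J := {p : ℕ × V // p.2 ∈ E p.1}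
  have hE' : ∀ j : J, ∃ s : StrategyGraph V, s.pos s.root = j.1.2 ∧
      s.Wins pre col W (D' j.1.1) (T' j.1.1) := fun j => hE _ _ j.2
  choose s hroot hwins using hE'
  let phase : J → ℕ := fun j => j.1.1
  refine ⟨⟨Σ j, (s j).Node, fun n => (s n.1).pos n.2, PhaseMove s phase D',
    ⟨⟨(0, v), hv⟩, (s _).root⟩⟩, hroot _, ?_, ?_, ?_⟩
  · rintro ⟨j, n⟩
    rcases (hwins j).mem n with h | h
    · exact Or.inl (hD _ h)
    · exact hT _ h
  · rintro ⟨j, n⟩ hn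
    by_cases hin : (s j).pos n ∈ D' (phase j)
    · refine hpre ?_ ((hwins j).step n hin)
      rintro _ ⟨n', hn', rfl⟩
      exact ⟨⟨j, n'⟩, .inner hin hn', rfl⟩
    · have hex : (s j).pos n ∈ T' (phase j) := ((hwins j).mem n).resolve_left hin
      refine hpre ?_ (hjump _ _ hex hin hn)
      intro w hw
      exact ⟨⟨⟨(phase j + 1, w), hw⟩, (s _).root⟩, .jump hin rfl, hroot ⟨(phase j + 1, w), hw⟩⟩
  · intro x hx hmove
    set out : ℕ → Prop := fun k => (s (x k).1).pos (x k).2 ∉ D' (phase (x k).1) with hout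
    classical
    have hphase : ∀ k, phase (x (k + 1)).1 = phase (x k).1 + if out k then 1 else 0 := by
      intro k
      have := hmove k
      simp only [hout]
      generalize x k = a at this
      generalize x (k + 1) = b at this
      cases this with
      | inner hn h => simp [hn]
      | jump hn h => simp [hn, h]
    by_cases hfin : {k | out k}.Finite
    · -- from some time on the play follows a single strategy
      obtain ⟨K, hK⟩ := hfin.bddAbove
      have hin : ∀ k, ¬ out (k + (K + 1)) := fun k hk => by
        have := hK hk
        omega
      have hj : ∀ k, ∃ n, x (k + (K + 1)) = ⟨(x (K + 1)).1, n⟩ := by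
        intro k
        induction k with
        | zero => exact ⟨(x (K + 1)).2, by simp⟩
        | succ k ih =>
          obtain ⟨n, hn⟩ := ih
          have hm := hmove (k + (K + 1))
          have ho := hin k
          rw [show k + 1 + (K + 1) = k + (K + 1) + 1 by omega]
          simp only [hout, not_not] at ho
          rw [hn] at hm ho
          generalize x (k + (K + 1) + 1) = b at hm
          cases hm with
          | inner _ h => exact ⟨_, rfl⟩
          | jump h _ => exact absurd ho h
      choose y hy using hj
      rw [← infColors_shift _ _ (K + 1)]
      have : (fun i => (s (x (i + (K + 1))).1).pos (x (i + (K + 1))).2) =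
          fun i => (s (x (K + 1)).1).pos (y i) := by
        funext i
        rw [hy i]
      have hgoal := (hwins (x (K + 1)).1).inf y ?_ ?_
      · rw [← this] at hgoal
        exact hgoal
      · intro i
        have := hin i
        simp only [hout, not_not] at this
        rw [hy i] at this
        exact this
      · intro i
        have hm := hmove (i + (K + 1))
        have ho := hin i
        simp only [hout, not_not] at ho
        rw [show i + (K + 1) + 1 = i + 1 + (K + 1) by omega, hy i, hy (i + 1)] at hm
        rw [hy i] at ho
        generalize y i = a at *
        generalize y (i + 1) = b at *
        cases hm with
        | inner _ h => exact h
        | jump h _ => exact absurd ho h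
    · -- there are infinitely many jumps, and the phase counts them
      have hinfi : {k | out k}.Infinite := hfin
      have hphase' : ∀ k l, k ≤ l → (∀ i, k ≤ i → i < l → ¬ out i) →
          phase (x l).1 = phase (x k).1 := by
        intro k l hkl
        induction l, hkl using Nat.le_induction with
        | base => intro _; rfl
        | succ l hl ih =>
          intro h
          rw [hphase, if_neg (h l hl (by omega)), add_zero, ih fun i h1 h2 => h i h1 (by omega)]
      refine hinf _ (phase (x (Nat.nth out 0)).1) (Nat.nth out) (Nat.nth_strictMono hinfi) hx ?_
      have hph : ∀ j, phase (x (Nat.nth out j)).1 = phase (x (Nat.nth out 0)).1 + j := by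
        intro j
        induction j with
        | zero => rfl
        | succ j ih =>
          have hlt : Nat.nth out j < Nat.nth out (j + 1) :=
            Nat.nth_strictMono hinfi (Nat.lt_succ_self j)
          rw [hphase' (Nat.nth out j + 1) _ hlt, hphase,
            if_pos (Nat.nth_mem_of_infinite hinfi j), ih]
          · omega
          · exact fun i h1 h2 => nth_succ_gap hinfi h1 h2
      intro j
      have hmem : out (Nat.nth out j) := Nat.nth_mem_of_infinite hinfi j
      rw [← hph j]
      exact ⟨((hwins _).mem _).resolve_left hmem, hmem⟩

/-! ### Determinacy of Muller games -/

section Determinacy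

variable {V C : Type} [DecidableEq C]

/-- The set of those `v ∈ D` of colour `c` from which the next position can be forced to be
in `Z`. -/
def colorPre (pre : Set V → Set V) (col : V → C) (D : Set V) (c : C) (Z : Set V) : Set V :=
  {v | v ∈ D ∧ col v = c ∧ v ∈ pre Z}

/-- The positions of `D` from which, for each of the colours `c ∈ K`, the player can either reach
the colour `c` and continue in `X ∪ T`, or reach `T`, or win without ever seeing `c`. The last
two possibilities are described by `rec`. -/
def recurStep (rec : Finset C → Set V → Set V → Set V) (pre : Set V → Set V) (col : V → C)
    (K : Finset C) (D T X : Set V) : Set V :=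
  {v | v ∈ D ∧ ∀ c ∈ K, v ∈ colorPre pre col D c (X ∪ T) ∨
    v ∈ rec (K.erase c) {w | w ∈ D ∧ col w ≠ c} (T ∪ colorPre pre col D c (X ∪ T))}

/-- The greatest fixpoint of a set operator. -/
def nuSet (Γ : Set V → Set V) : Set V :=
  {v | ∃ X : Set V, X ⊆ Γ X ∧ v ∈ X}

/-- The winning region of player `P` in the game with domain `D`, all of whose colours belong to
`K`, and with exits `T` good for `P`; player `true` wants the set of infinitely recurring colours
to be in `F`. The player who wins when all colours of `K` recur gets a greatest fixpoint, which
refers to the winning regions for one colour less; the other player gets the complement. The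
recursion is on a bound for the number of colours. -/
def winRegion (pre : Bool → Set V → Set V) (col : V → C) (F : Set (Set C)) :
    ℕ → Bool → Finset C → Set V → Set V → Set V
  | 0, _, _, _, _ => ∅
  | n + 1, P, K, D, T =>
    {v | (((K : Set C) ∈ F ↔ P = true) ∧
        v ∈ nuSet (recurStep (winRegion pre col F n P) (pre P) col K D T)) ∨
      (¬ ((K : Set C) ∈ F ↔ P = true) ∧ v ∈ D ∧
        v ∉ nuSet (recurStep (winRegion pre col F n !P) (pre !P) col K D (D ∪ T)ᶜ))}

/-- The winning sets of recurring colours for player `P`. -/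
def goodFor (F : Set (Set C)) (P : Bool) : Set (Set C) := {S | S ∈ F ↔ P = true}

/-- The player who wins when all colours recur ensures the objective on the greatest fixpoint: he
aims for each of the colours again and again, in turn. -/
theorem ensures_of_postfixed {pre : Set V → Set V} (hpre : Monotone pre) {col : V → C}
    {W : Set (Set C)} {K : Finset C} (hK : (K : Set C) ∈ W) {D T : Set V}
    (hDT : Disjoint D T) (hD : ∀ v ∈ D, col v ∈ K) {rec : Finset C → Set V → Set V → Set V}
    (hrec : ∀ c ∈ K, ∀ D T : Set V, (∀ v ∈ D, col v ∈ K.erase c) → Disjoint D T →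
      ∀ v ∈ rec (K.erase c) D T, Ensures pre col W D T v)
    {X : Set V} (hX : X ⊆ recurStep rec pre col K D T X) {v : V} (hv : v ∈ X) :
    Ensures pre col W D T v := by
  have hvK : col v ∈ K := hD v (hX hv).1
  -- phase `i` aims for the colour `e i`, and each colour of `K` is `e i` for infinitely many `i`
  have : Nonempty ({c // c ∈ K} × ℕ) := ⟨(⟨col v, hvK⟩, 0)⟩
  obtain ⟨e₀, he₀⟩ := exists_surjective_nat ({c // c ∈ K} × ℕ)
  let e : ℕ → C := fun i => (e₀ i).1
  have heK : ∀ i, e i ∈ K := fun i => (e₀ i).1.2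
  have he : ∀ c ∈ K, ∀ i, ∃ j ≥ i, e j = c := by
    intro c hc i
    by_contra! hcon
    choose g hg using fun k : ℕ => he₀ ((⟨c, hc⟩ : {c // c ∈ K}), k)
    have hinj : Function.Injective g := fun a b hab => by
      have := (hg a).symm.trans ((congrArg e₀ hab).trans (hg b))
      exact (Prod.ext_iff.1 this).2
    have hlt : ∀ k, g k < i := fun k => by
      by_contra hk
      exact hcon (g k) (by omega) (by simp [e, hg k])
    exact Set.infinite_of_injective_forall_mem (s := Set.Iio i) hinj hlt (Set.finite_Iio i)
  let Y : C → Set V := fun c => colorPre pre col D c (X ∪ T)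
  refine Ensures.glue hpre (fun i => {w | w ∈ D ∧ col w ≠ e i}) (fun i => T ∪ Y (e i))
    (fun _ => X ∪ T) (fun i w hw => hw.1) ?_ ?_ ?_ ?_ (Or.inl hv)
  · rintro i w (hw | hw)
    · exact Or.inr hw
    · exact Or.inl hw.1
  · rintro i w (hw | hw) _ hwD
    · exact absurd hw (Set.disjoint_left.1 hDT hwD)
    · exact hw.2.2
  · rintro i w (hw | hw)
    · rcases (hX hw).2 (e i) (heK i) with h | h
      · exact Ensures.of_mem (Or.inr h) fun h' => h'.2 h.2.1
      · refine hrec (e i) (heK i) _ _ ?_ ?_ w h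
        · exact fun u hu => Finset.mem_erase.2 ⟨hu.2, hD u hu.1⟩
        · refine Set.disjoint_left.2 ?_
          rintro u hu (hu' | hu')
          · exact Set.disjoint_left.1 hDT hu.1 hu'
          · exact hu.2 hu'.2.1
    · exact Ensures.of_mem (Or.inl hw) fun h => Set.disjoint_left.1 hDT h.1 hw
  · intro x i κ hκ hxD hx
    suffices infColors col x = (K : Set C) by rwa [this]
    ext c
    constructor
    · intro hc
      obtain ⟨k, hk⟩ := hc.exists
      exact hk ▸ hD _ (hxD k)
    · intro hc
      refine Filter.frequently_atTop.2 fun a => ?_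
      obtain ⟨j, hj, hjc⟩ := he c hc (i + a)
      refine ⟨κ (j - i), le_trans (by omega) (hκ.le_apply (x := j - i)), ?_⟩
      have := (hx (j - i)).1
      rw [show i + (j - i) = j by omega] at this
      rcases this with h | h
      · exact absurd h (Set.disjoint_left.1 hDT (hxD _))
      · exact h.2.1.trans hjc

/-- Outside of the greatest fixpoint the opponent ensures his objective: the complement of the set
where he does is a postfixpoint. -/
theorem ensures_of_notMem_nuSet {pre pre' : Set V → Set V} (hpre' : Monotone pre')
    (hdual : ∀ Z, pre' Zᶜ = (pre Z)ᶜ) {col : V → C}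
    {W : Set (Set C)} {K : Finset C} {D T : Set V}
    (hDT : Disjoint D T) (hD : ∀ v ∈ D, col v ∈ K) {rec : Finset C → Set V → Set V → Set V}
    (hrec : ∀ c ∈ K, ∀ D T : Set V, (∀ v ∈ D, col v ∈ K.erase c) → Disjoint D T →
      ∀ v ∈ D, v ∉ rec (K.erase c) D T → Ensures pre' col W D (D ∪ T)ᶜ v)
    {v : V} (hvD : v ∈ D) (hv : v ∉ nuSet (recurStep rec pre col K D T)) :
    Ensures pre' col W D (D ∪ T)ᶜ v := by
  by_contra hnot
  refine hv ⟨{w | w ∈ D ∧ ¬ Ensures pre' col W D (D ∪ T)ᶜ w}, ?_, hvD, hnot⟩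
  clear hnot hv hvD v
  rintro v ⟨hvD, hv⟩
  refine ⟨hvD, fun c hc => ?_⟩
  by_contra! hcon
  set Z : Set V := {w | w ∈ D ∧ ¬ Ensures pre' col W D (D ∪ T)ᶜ w} with hZ
  set Y : Set V := colorPre pre col D c (Z ∪ T) with hY
  obtain ⟨hvY, hvr⟩ := hcon
  apply hv
  -- in phase `0` the opponent plays without the colour `c`; once he exits through `c`, he forces
  -- the next position out of `Z ∪ T`, where he has won or has a strategy for the later phases
  let D₀ : Set V := {w | w ∈ D ∧ col w ≠ c}
  have hcase : ∀ w ∉ Z ∪ T, Ensures pre' col W D (D ∪ T)ᶜ w := by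
    intro w hw
    by_cases hwD : w ∈ D
    · by_contra h
      exact hw (Or.inl ⟨hwD, h⟩)
    · exact Ensures.of_mem (fun h => h.elim hwD fun h => hw (Or.inr h)) hwD
  refine Ensures.glue hpre' (fun i => if i = 0 then D₀ else D)
    (fun i => if i = 0 then (D₀ ∪ (T ∪ Y))ᶜ else (D ∪ T)ᶜ)
    (fun i => if i = 0 then {v} else (Z ∪ T)ᶜ) ?_ ?_ ?_ ?_ ?_ (by simp)
  · intro i
    split_ifs
    · exact fun w hw => hw.1
    · exact subset_rfl
  · intro i w
    split_ifs
    · intro hw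
      by_cases hwD : w ∈ D
      · exact Or.inl hwD
      · exact Or.inr fun h => h.elim hwD fun h => hw (Or.inr (Or.inl h))
    · exact fun h => Or.inr h
  · intro i w
    rw [if_neg (Nat.succ_ne_zero i)]
    split_ifs
    · intro hw hw₀ hwD
      rw [hdual]
      intro hcon
      have hcol : col w = c := by
        by_contra h
        exact hw₀ ⟨hwD, h⟩
      exact hw (Or.inr (Or.inr ⟨hwD, hcol, hcon⟩))
    · exact fun _ h h' => absurd h' h
  · intro i w
    split_ifs
    · intro hw
      obtain rfl : w = v := hw
      by_cases hcol : col w = c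
      · refine Ensures.of_mem ?_ fun h => h.2 hcol
        rintro (h | h | h)
        · exact h.2 hcol
        · exact Set.disjoint_left.1 hDT hvD h
        · exact hvY h
      · refine hrec c hc D₀ (T ∪ Y) ?_ ?_ w ⟨hvD, hcol⟩ hvr
        · exact fun u hu => Finset.mem_erase.2 ⟨hu.2, hD u hu.1⟩
        · refine Set.disjoint_left.2 ?_
          rintro u hu (hu' | hu')
          · exact Set.disjoint_left.1 hDT hu.1 hu'
          · exact hu.2 hu'.2.1
    · exact hcase w
  · intro x i κ hκ hxD hx
    have := (hx 1).1
    rw [if_neg (by omega)] at this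
    exact absurd (Or.inl (hxD _)) this

/-- Determinacy of Muller games: inside of `winRegion` player `P` ensures his objective, outside of
it the opponent ensures the complementary one. -/
theorem winRegion_spec {pre : Bool → Set V → Set V} (hpre : ∀ P, Monotone (pre P))
    (hdual : ∀ P Z, pre (!P) Zᶜ = (pre P Z)ᶜ) (col : V → C) (F : Set (Set C)) (n : ℕ) :
    ∀ (P : Bool) (K : Finset C) (D T : Set V), K.card ≤ n → Disjoint D T →
      (∀ v ∈ D, col v ∈ K) →
      (∀ v ∈ winRegion pre col F n P K D T, Ensures (pre P) col (goodFor F P) D T v) ∧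
      ∀ v ∈ D, v ∉ winRegion pre col F n P K D T →
        Ensures (pre !P) col (goodFor F !P) D (D ∪ T)ᶜ v := by
  induction n with
  | zero =>
    intro P K D T hK hDT hD
    have : K = ∅ := by simpa using hK
    subst this
    exact ⟨fun v hv => absurd hv (Set.notMem_empty v), fun v hv => absurd (hD v hv) (by simp)⟩
  | succ n ih =>
    -- the two halves for the player who wins when all colours recur
    have main : ∀ (P : Bool) (K : Finset C) (D T : Set V), K.card ≤ n + 1 → Disjoint D T →
        (∀ v ∈ D, col v ∈ K) → ((K : Set C) ∈ F ↔ P = true) →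
        (∀ v ∈ nuSet (recurStep (winRegion pre col F n P) (pre P) col K D T),
          Ensures (pre P) col (goodFor F P) D T v) ∧
        ∀ v ∈ D, v ∉ nuSet (recurStep (winRegion pre col F n P) (pre P) col K D T) →
          Ensures (pre !P) col (goodFor F !P) D (D ∪ T)ᶜ v := by
      intro P K D T hK hDT hD hown
      have hcard : ∀ c ∈ K, (K.erase c).card ≤ n := fun c hc => by
        rw [Finset.card_erase_of_mem hc]
        omega
      refine ⟨?_, fun v hvD hv => ?_⟩
      · rintro v ⟨X, hX, hv⟩
        exact ensures_of_postfixed (hpre P) hown hDT hD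
          (fun c hc D T hD hDT => (ih P _ D T (hcard c hc) hDT hD).1) hX hv
      · exact ensures_of_notMem_nuSet (hpre _) (hdual P) hDT hD
          (fun c hc D T hD hDT => (ih P _ D T (hcard c hc) hDT hD).2) hvD hv
    intro P K D T hK hDT hD
    by_cases hown : ((K : Set C) ∈ F ↔ P = true)
    · obtain ⟨h1, h2⟩ := main P K D T hK hDT hD hown
      have heq : winRegion pre col F (n + 1) P K D T =
          nuSet (recurStep (winRegion pre col F n P) (pre P) col K D T) := by
        ext v
        simp only [winRegion, Set.mem_ofPred_eq]
        tauto
      rw [heq]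
      exact ⟨h1, h2⟩
    · have hown' : ((K : Set C) ∈ F ↔ (!P) = true) := by
        cases P <;> simp_all
      obtain ⟨h1, h2⟩ := main (!P) K D (D ∪ T)ᶜ hK
        (Set.disjoint_left.2 fun v hv hv' => hv' (Or.inl hv)) hD hown'
      have heq : ∀ v, v ∈ winRegion pre col F (n + 1) P K D T ↔ v ∈ D ∧
          v ∉ nuSet (recurStep (winRegion pre col F n !P) (pre !P) col K D (D ∪ T)ᶜ) := by
        intro v
        simp only [winRegion, Set.mem_ofPred_eq]
        tauto
      simp only [heq]
      have hT : (D ∪ (D ∪ T)ᶜ)ᶜ = T := by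
        ext v
        have hv : v ∈ D → v ∉ T := fun h => Set.disjoint_left.1 hDT h
        simp only [Set.mem_compl_iff, Set.mem_union]
        tauto
      rw [Bool.not_not, hT] at h2
      refine ⟨fun v hv => h2 v hv.1 hv.2, fun v hvD hv => h1 v ?_⟩
      by_contra h
      exact hv ⟨hvD, h⟩

end Determinacy

/-! ### Strategy graphs for alternating automata -/

namespace PosExpr

variable {X : Type}

/-- Player `P` can play on the expression `e` so that the atom that is reached satisfies `K`. -/
def Force : Bool → PosExpr X → (X → Prop) → Prop
  | _, .atom x, K => K x
  | true, .and e₁ e₂, K => Force true e₁ K ∧ Force true e₂ K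
  | false, .and e₁ e₂, K => Force false e₁ K ∨ Force false e₂ K
  | true, .or e₁ e₂, K => Force true e₁ K ∨ Force true e₂ K
  | false, .or e₁ e₂, K => Force false e₁ K ∧ Force false e₂ K

theorem Force.mono {P : Bool} {e : PosExpr X} {K K' : X → Prop} (h : ∀ x, K x → K' x)
    (hK : Force P e K) : Force P e K' := by
  induction e with
  | atom x => exact h x hK
  | and e₁ e₂ h1 h2 | or e₁ e₂ h1 h2 =>
    cases P
    all_goals
      simp only [Force] at hK ⊢
      tauto

theorem force_not {P : Bool} {e : PosExpr X} {K : X → Prop} :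
    Force (!P) e (fun x => ¬ K x) ↔ ¬ Force P e K := by
  induction e with
  | atom x => cases P <;> exact Iff.rfl
  | and e₁ e₂ h1 h2 | or e₁ e₂ h1 h2 =>
    cases P
    all_goals
      simp only [Force, Bool.not_false, Bool.not_true] at h1 h2 ⊢
      tauto

end PosExpr

namespace AltAutomaton

variable {S Q : Type}

/-- The one-round operator of the acceptance game on `t`, seen as a game on pairs `(u, q)`. -/
def pre (A : AltAutomaton S Q) (t : LabeledTree S) (P : Bool) (Z : Set (List Bool × Q)) :
    Set (List Bool × Q) :=
  {v | (A.trans v.2 (t v.1)).Force P fun x => (v.1 ++ [x.1], x.2) ∈ Z}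

theorem pre_mono (A : AltAutomaton S Q) (t : LabeledTree S) (P : Bool) :
    Monotone (A.pre t P) :=
  fun _ _ h _ hv => PosExpr.Force.mono (fun _ hx => h hx) hv

theorem pre_compl (A : AltAutomaton S Q) (t : LabeledTree S) (P : Bool)
    (Z : Set (List Bool × Q)) : A.pre t (!P) Zᶜ = (A.pre t P Z)ᶜ := by
  ext v
  exact PosExpr.force_not

/-- The operator of expressions that is resolved by player `P`. -/
def ownOp {X : Type} : Bool → PosExpr X → PosExpr X → PosExpr X
  | true => .or
  | false => .and

section Tracking

variable (s : StrategyGraph (List Bool × Q))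

/-- The configuration agrees with the node `n` of the strategy graph. -/
def Agrees (P : Bool) (n : s.Node) : Config Q → Prop
  | .state u q => s.pos n = (u, q)
  | .expr u e => (s.pos n).1 = u ∧
      e.Force P fun x => ∃ n', s.Move n n' ∧ s.pos n' = (u ++ [x.1], x.2)

open Classical in
/-- The node reached from `n` when the play moves on to a given configuration. A node that already
lies over the configuration is kept; this concerns only the initial configuration, as the
vertex changes between successive configurations `⟨u, q⟩`. -/
noncomputable def trackNext (n : s.Node) : Config Q → s.Node
  | .state u q =>
    if s.pos n = (u, q) then n
    else if h : ∃ n', s.Move n n' ∧ s.pos n' = (u, q) then h.choose else n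
  | .expr _ _ => n

/-- The nodes of the strategy graph passed by a play. -/
noncomputable def track (π : ℕ → Config Q) : ℕ → s.Node
  | 0 => s.root
  | k + 1 => trackNext s (track π k) (π (k + 1))

variable {s} {A : AltAutomaton S Q} {t : LabeledTree S} {P : Bool}

theorem exists_state_ge {π : ℕ → Config Q} (hπ : A.IsPlay t π) (k : ℕ) :
    ∃ j ≥ k, ∃ u q, π j = .state u q := by
  have key : ∀ (e : PosExpr (Bool × Q)) (u : List Bool) (k : ℕ), π k = .expr u e →
      ∃ j ≥ k, ∃ u q, π j = .state u q := by
    intro e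
    induction e with
    | atom x =>
      intro u k hk
      have := hπ.2 k
      rw [hk] at this
      exact ⟨k + 1, by omega, _, _, this⟩
    | and e₁ e₂ h1 h2 | or e₁ e₂ h1 h2 =>
      intro u k hk
      have := hπ.2 k
      rw [hk] at this
      rcases this with h | h
      · obtain ⟨j, hj, h⟩ := h1 u _ h
        exact ⟨j, by omega, h⟩
      · obtain ⟨j, hj, h⟩ := h2 u _ h
        exact ⟨j, by omega, h⟩
  cases hk : π k with
  | state u q => exact ⟨k, le_rfl, u, q, hk⟩
  | expr u e => exact key e u k hk

theorem trackNext_spec {n : s.Node} {u : List Bool} {x : Bool × Q} (hn : (s.pos n).1 = u)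
    (h : ∃ n', s.Move n n' ∧ s.pos n' = (u ++ [x.1], x.2)) :
    s.Move n (trackNext s n (.state (u ++ [x.1]) x.2)) ∧
      s.pos (trackNext s n (.state (u ++ [x.1]) x.2)) = (u ++ [x.1], x.2) := by
  have hne : s.pos n ≠ (u ++ [x.1], x.2) := fun h' => by
    have := congrArg (fun p => List.length p.1) h'
    simp [hn] at this
  simp only [trackNext, if_neg hne, dif_pos h]
  exact h.choose_spec

/-- A play of the acceptance game in which player `P` makes his choices according to a strategy
graph that wins the game on pairs `(u, q)` is good for player `P`. -/
theorem infStates_mem_of_track (hs : s.pos s.root = ([], A.init))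
    (hwin : s.Wins (A.pre t P) Prod.snd (goodFor A.muller P) Set.univ ∅)
    {π : ℕ → Config Q} (hπ : A.IsPlay t π)
    (hown : ∀ k u e₁ e₂, Agrees s P (track s π k) (π k) → π k = .expr u (ownOp P e₁ e₂) →
      Agrees s P (track s π k) (π (k + 1))) :
    infStates π ∈ goodFor A.muller P := by
  have hstep : ∀ k, Agrees s P (track s π k) (π k) →
      Agrees s P (track s π (k + 1)) (π (k + 1)) ∧
      ((∃ u q, π (k + 1) = .state u q) → s.Move (track s π k) (track s π (k + 1))) ∧
      ((¬ ∃ u q, π (k + 1) = .state u q) → track s π (k + 1) = track s π k) := by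
    intro k hk
    have hst := hπ.2 k
    have ho := hown k
    simp only [track]
    generalize track s π k = n at *
    cases hc : π k with
    | state u q =>
      rw [hc] at hk hst
      rw [show π (k + 1) = _ from hst]
      refine ⟨⟨congrArg Prod.fst hk, ?_⟩, by simp, fun _ => rfl⟩
      have h := hwin.step n (Set.mem_univ _)
      rw [show s.pos n = _ from hk] at h
      exact PosExpr.Force.mono (fun x ⟨n', h1, h2⟩ => ⟨n', h1, h2⟩) h
    | expr u e =>
      rw [hc] at hk hst ho
      cases e with
      | atom x =>
        obtain ⟨hn, hx⟩ := hk
        obtain ⟨h1, h2⟩ := trackNext_spec hn hx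
        rw [show π (k + 1) = _ from hst]
        exact ⟨h2, fun _ => h1, fun h => absurd ⟨_, _, rfl⟩ h⟩
      | and e₁ e₂ =>
        have hag : Agrees s P n (π (k + 1)) := by
          cases P with
          | false => exact ho u e₁ e₂ hk rfl
          | true => rcases hst with h | h <;> rw [h]; exacts [⟨hk.1, hk.2.1⟩, ⟨hk.1, hk.2.2⟩]
        rcases hst with h | h <;> rw [h] at hag ⊢ <;> exact ⟨hag, by simp, fun _ => rfl⟩
      | or e₁ e₂ =>
        have hag : Agrees s P n (π (k + 1)) := by
          cases P with
          | true => exact ho u e₁ e₂ hk rfl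
          | false => rcases hst with h | h <;> rw [h]; exacts [⟨hk.1, hk.2.1⟩, ⟨hk.1, hk.2.2⟩]
        rcases hst with h | h <;> rw [h] at hag ⊢ <;> exact ⟨hag, by simp, fun _ => rfl⟩
  have hagree : ∀ k, Agrees s P (track s π k) (π k) := by
    intro k
    induction k with
    | zero => rw [hπ.1]; exact hs
    | succ k ih => exact (hstep k ih).1
  -- the nodes at the times of the configurations `⟨u, q⟩` form a path of the strategy graph
  let p : ℕ → Prop := fun k => ∃ u q, π k = .state u q
  have hp : {k | p k}.Infinite := Set.infinite_of_forall_exists_gt fun k => by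
    obtain ⟨j, hj, h⟩ := exists_state_ge hπ (k + 1)
    exact ⟨j, h, by omega⟩
  let x : ℕ → s.Node := fun i => track s π (Nat.nth p i)
  have hx : ∀ i, s.Move (x i) (x (i + 1)) := by
    intro i
    have hlt : Nat.nth p i < Nat.nth p (i + 1) := Nat.nth_strictMono hp (Nat.lt_succ_self i)
    have hconst : ∀ k, Nat.nth p i ≤ k → k < Nat.nth p (i + 1) → track s π k = x i := by
      intro k hk
      induction k, hk using Nat.le_induction with
      | base => intro _; rfl
      | succ k hk ih =>
        intro h
        rw [← ih (by omega)]
        exact (hstep k (hagree k)).2.2 (nth_succ_gap hp (by omega) h)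
    have hm := (hstep (Nat.nth p (i + 1) - 1) (hagree _)).2.1
    rw [Nat.sub_add_cancel (by omega), hconst _ (by omega) (by omega)] at hm
    exact hm (Nat.nth_mem_of_infinite hp _)
  have hpos : ∀ k u q, π k = .state u q → s.pos (track s π k) = (u, q) := by
    intro k u q hk
    have := hagree k
    rw [hk] at this
    exact this
  have hinf := hwin.inf x (fun _ => Set.mem_univ _) hx
  suffices infColors Prod.snd (fun i => s.pos (x i)) = infStates π by rwa [← this]
  ext q
  simp only [infColors, infStates, Set.mem_ofPred_eq, Filter.frequently_atTop]
  constructor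
  · intro h a
    obtain ⟨i, hi, hq⟩ := h a
    obtain ⟨u, q', hu⟩ := Nat.nth_mem_of_infinite hp i
    refine ⟨Nat.nth p i, hi.trans (Nat.nth_strictMono hp).le_apply, u, ?_⟩
    rw [hpos _ _ _ hu] at hq
    exact (show q' = q from hq) ▸ hu
  · classical
    intro h a
    obtain ⟨k, hk, u, hu⟩ := h (Nat.nth p a)
    have hpk : p k := ⟨u, q, hu⟩
    have hc := Nat.nth_count hpk
    refine ⟨Nat.count p k, (Nat.nth_strictMono hp).le_iff_le.1 (by rwa [hc]), ?_⟩
    simp only [x, hc, hpos _ _ _ hu]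

open Classical in
/-- The strategy of the existential player that follows a strategy graph. -/
noncomputable def followGraph (s : StrategyGraph (List Bool × Q)) : Strategy Q := fun h =>
  match h.getLast? with
  | some (.expr u (.or e₁ _)) => decide (Agrees s true (h.foldl (trackNext s) s.root) (.expr u e₁))
  | _ => false

theorem foldl_trackNext (hs : s.pos s.root = ([], A.init)) {π : ℕ → Config Q}
    (hπ : π 0 = .state [] A.init) (k : ℕ) :
    ((List.range (k + 1)).map π).foldl (trackNext s) s.root = track s π k := by
  induction k with
  | zero => simp [hπ, trackNext, hs, track]
  | succ k ih => rw [List.range_succ, List.map_append, List.foldl_append, ih]; rfl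

/-- If the existential player has a winning strategy graph, then `t` is accepted. -/
theorem mem_language_of_graph (hs : s.pos s.root = ([], A.init))
    (hwin : s.Wins (A.pre t true) Prod.snd (goodFor A.muller true) Set.univ ∅) :
    t ∈ A.language := by
  refine ⟨followGraph s, fun π hπ hc => ?_⟩
  have h := infStates_mem_of_track hs hwin hπ ?_
  · simpa [goodFor] using h
  · intro k u e₁ e₂ hag hk
    have hlast : ((List.range (k + 1)).map π).getLast? = some (.expr u (.or e₁ e₂)) := by
      rw [List.range_succ, List.map_append]
      simpa using (show π k = .expr u (.or e₁ e₂) from hk)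
    classical
    rw [hc k u e₁ e₂ hk, followGraph, hlast]
    dsimp only
    rw [foldl_trackNext hs hπ.1]
    rw [hk] at hag
    by_cases h1 : Agrees s true (track s π k) (.expr u e₁)
    · rwa [decide_eq_true h1]
    · rw [decide_eq_false h1]
      exact ⟨hag.1, hag.2.resolve_left fun h => h1 ⟨hag.1, h⟩⟩

open Classical in
/-- The next configuration of the play in which the universal player follows a strategy graph
whose current node is `n`, and the existential player decides by `b`. -/
noncomputable def nextAgainst (A : AltAutomaton S Q) (t : LabeledTree S)
    (s : StrategyGraph (List Bool × Q)) (b : Bool) (n : s.Node) : Config Q → Config Q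
  | .state u q => .expr u (A.trans q (t u))
  | .expr u (.atom x) => .state (u ++ [x.1]) x.2
  | .expr u (.and e₁ e₂) => .expr u (if Agrees s false n (.expr u e₁) then e₁ else e₂)
  | .expr u (.or e₁ e₂) => .expr u (bif b then e₁ else e₂)

/-- The history, the configuration and the node after `k` moves when the universal player follows
a strategy graph against the strategy `σ`. -/
noncomputable def playAgainst (A : AltAutomaton S Q) (t : LabeledTree S)
    (s : StrategyGraph (List Bool × Q)) (σ : Strategy Q) :
    ℕ → List (Config Q) × Config Q × s.Node
  | 0 => ([.state [] A.init], .state [] A.init, s.root)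
  | k + 1 =>
    let p := playAgainst A t s σ k
    let c := nextAgainst A t s (σ p.1) p.2.2 p.2.1
    (p.1 ++ [c], c, trackNext s p.2.2 c)

/-- If the universal player has a winning strategy graph, then his play defeats every strategy of
the existential player. -/
theorem notMem_language_of_graph (hs : s.pos s.root = ([], A.init))
    (hwin : s.Wins (A.pre t false) Prod.snd (goodFor A.muller false) Set.univ ∅) :
    t ∉ A.language := by
  rintro ⟨σ, hσ⟩
  let π : ℕ → Config Q := fun k => (playAgainst A t s σ k).2.1
  have hhist : ∀ k, (playAgainst A t s σ k).1 = (List.range (k + 1)).map π := by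
    intro k
    induction k with
    | zero => rfl
    | succ k ih => rw [List.range_succ, List.map_append, ← ih]; rfl
  have htrack : ∀ k, (playAgainst A t s σ k).2.2 = track s π k := by
    intro k
    induction k with
    | zero => rfl
    | succ k ih => rw [track, ← ih]; rfl
  have hnext : ∀ k, π (k + 1) =
      nextAgainst A t s (σ ((List.range (k + 1)).map π)) (track s π k) (π k) := by
    intro k
    rw [← hhist, ← htrack]
    rfl
  have hπ : A.IsPlay t π := by
    refine ⟨rfl, fun k => ?_⟩
    rw [hnext]
    cases π k with
    | state u q => rfl
    | expr u e =>
      cases e with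
      | atom x => rfl
      | and e₁ e₂ => simp only [nextAgainst, Step]; split_ifs <;> simp
      | or e₁ e₂ =>
        simp only [nextAgainst, Step]
        cases σ ((List.range (k + 1)).map π) <;> simp
  have h1 := hσ π hπ fun k u e₁ e₂ hk => by rw [hnext, hk]; rfl
  have h2 := infStates_mem_of_track hs hwin hπ ?_
  · simp only [goodFor, Set.mem_ofPred_eq, Bool.false_eq_true, iff_false] at h2
    exact h2 h1
  · intro k u e₁ e₂ hag hk
    rw [hnext]
    rw [hk] at hag ⊢
    simp only [ownOp, nextAgainst]
    split_ifs with h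
    · exact h
    · exact ⟨hag.1, hag.2.resolve_left fun h' => h ⟨hag.1, h'⟩⟩

end Tracking

/-- A strategy of player `P` in the game on pairs `(u, q)` decides acceptance. -/
theorem mem_language_iff_of_ensures {A : AltAutomaton S Q} {t : LabeledTree S} {P : Bool}
    (h : Ensures (A.pre t P) Prod.snd (goodFor A.muller P) Set.univ ∅ ([], A.init)) :
    t ∈ A.language ↔ P = true := by
  obtain ⟨s, hs, hwin⟩ := h
  cases P with
  | true => simpa using mem_language_of_graph hs hwin
  | false => simpa using notMem_language_of_graph hs hwin

/-- Acceptance games are determined, and their winning regions are nested fixpoints. -/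
theorem ensures_iff_mem_language [Fintype Q] [DecidableEq Q] (A : AltAutomaton S Q)
    (t : LabeledTree S) :
    (t ∈ A.language ↔ ([], A.init) ∈ winRegion (A.pre t) Prod.snd A.muller
      (Fintype.card Q) true Finset.univ Set.univ ∅) ∧
    ∃ P, Ensures (A.pre t P) Prod.snd (goodFor A.muller P) Set.univ ∅ ([], A.init) := by
  obtain ⟨h1, h2⟩ := winRegion_spec (A.pre_mono t) (A.pre_compl t) Prod.snd A.muller
    (Fintype.card Q) true Finset.univ Set.univ ∅ le_rfl (Set.disjoint_empty _)
    fun _ _ => Finset.mem_univ _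
  simp only [Set.univ_union, Set.compl_univ, Bool.not_true] at h2
  by_cases h : ([], A.init) ∈ winRegion (A.pre t) Prod.snd A.muller
      (Fintype.card Q) true Finset.univ Set.univ ∅
  · exact ⟨by simp [h, mem_language_iff_of_ensures (h1 _ h)], true, h1 _ h⟩
  · have := h2 _ (Set.mem_univ _) h
    exact ⟨by simp [h, mem_language_iff_of_ensures this], false, this⟩

end AltAutomaton

/-! ### Definability in S2S -/

/-- The formula that binds all second-order variables of a list. -/
def S2S.allList (l : List ℕ) (φ : S2S) : S2S := l.foldr S2S.all₂ φ

theorem S2S.sat_allList (l : List ℕ) (φ : S2S) (v : ℕ → List Bool) (V : ℕ → Set (List Bool)) :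
    (S2S.allList l φ).Sat v V ↔
      ∀ V' : ℕ → Set (List Bool), (∀ i ∉ l, V' i = V i) → φ.Sat v V' := by
  induction l generalizing V with
  | nil =>
    constructor
    · intro h V' hV
      rwa [show V' = V from funext fun i => hV i (by simp)]
    · exact fun h => h V fun _ _ => rfl
  | cons x l ih =>
    change (∀ U, (S2S.allList l φ).Sat v (Function.update V x U)) ↔ _
    simp only [ih]
    constructor
    · intro h V' hV
      refine h (V' x) V' fun i hi => ?_
      by_cases hix : i = x
      · simp [hix]
      · rw [Function.update_of_ne hix]
        exact hV i (by simp [hix, hi])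
    · intro h U V' hV
      refine h V' fun i hi => ?_
      simp only [List.mem_cons, not_or] at hi
      rw [hV i hi.2, Function.update_of_ne hi.1]

/-- Definability in S2S of a property of a vertex and of sets of vertices indexed by `ι`, for
whatever names the variables are given. -/
def Definable {ι : Type} (Φ : List Bool → (ι → Set (List Bool)) → Prop) : Prop :=
  ∀ (g : ι → ℕ) (x : ℕ), ∃ φ : S2S, ∀ v V, φ.Sat v V ↔ Φ (v x) fun i => V (g i)

namespace Definable

variable {ι : Type} {Φ Ψ : List Bool → (ι → Set (List Bool)) → Prop}

theorem congr (h : Definable Φ) (hΦ : ∀ u env, Ψ u env ↔ Φ u env) : Definable Ψ := by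
  rwa [show Ψ = Φ from funext fun u => funext fun env => propext (hΦ u env)]

theorem mem (i : ι) : Definable fun u (env : ι → Set (List Bool)) => u ∈ env i :=
  fun g x => ⟨.mem x (g i), fun _ _ => Iff.rfl⟩

theorem not (h : Definable Φ) : Definable fun u env => ¬ Φ u env := fun g x => by
  obtain ⟨φ, hφ⟩ := h g x
  exact ⟨.neg φ, fun v V => not_congr (hφ v V)⟩

theorem or (h : Definable Φ) (h' : Definable Ψ) : Definable fun u env => Φ u env ∨ Ψ u env :=
  fun g x => by
    obtain ⟨φ, hφ⟩ := h g x
    obtain ⟨ψ, hψ⟩ := h' g x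
    exact ⟨.or φ ψ, fun v V => or_congr (hφ v V) (hψ v V)⟩

theorem and (h : Definable Φ) (h' : Definable Ψ) : Definable fun u env => Φ u env ∧ Ψ u env :=
  (h.not.or h'.not).not.congr fun _ _ => by tauto

theorem imp (h : Definable Φ) (h' : Definable Ψ) : Definable fun u env => Φ u env → Ψ u env :=
  (h.not.or h').congr fun _ _ => by tauto

theorem const (p : Prop) : Definable fun _ (_ : ι → Set (List Bool)) => p := fun _ x => by
  by_cases hp : p
  · exact ⟨.or (.mem x 0) (.neg (.mem x 0)), fun v V => by simp [S2S.Sat, hp, em]⟩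
  · exact ⟨.neg (.or (.mem x 0) (.neg (.mem x 0))), fun v V => by simp [S2S.Sat, hp, em]⟩

theorem all {β : Type} [Finite β] {Φ : β → List Bool → (ι → Set (List Bool)) → Prop}
    (h : ∀ b, Definable (Φ b)) : Definable fun u env => ∀ b, Φ b u env := by
  classical
  have : Fintype β := Fintype.ofFinite β
  have key : ∀ s : Finset β, Definable fun u env => ∀ b ∈ s, Φ b u env := by
    intro s
    induction s using Finset.induction_on with
    | empty => exact (const True).congr fun _ _ => by simp
    | insert b s _ ih => exact ((h b).and ih).congr fun _ _ => by simp
  exact (key Finset.univ).congr fun _ _ => by simp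

theorem ex {β : Type} [Finite β] {Φ : β → List Bool → (ι → Set (List Bool)) → Prop}
    (h : ∀ b, Definable (Φ b)) : Definable fun u env => ∃ b, Φ b u env :=
  (all fun b => (h b).not).not.congr fun _ _ => by simp

theorem child (d : Bool) (h : Definable Φ) : Definable fun u env => Φ (u ++ [d]) env :=
  fun g x => by
    obtain ⟨φ, hφ⟩ := h g (x + 1)
    refine ⟨.all₁ (x + 1) (.or (.neg ((bif d then S2S.succR else S2S.succL) x (x + 1))) φ),
      fun v V => ?_⟩
    cases d <;> simp [S2S.Sat, hφ, ← imp_iff_not_or]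

theorem atRoot (h : Definable Φ) : Definable fun _ env => Φ [] env := fun g x => by
  obtain ⟨φ, hφ⟩ := h g x
  -- the root is the only vertex that is no child
  refine ⟨.all₁ x (.or (.neg (.all₁ (x + 1) (.neg (.or (.succL (x + 1) x)
    (.succR (x + 1) x))))) φ), fun v V => ?_⟩
  simp only [S2S.Sat, hφ, Function.update_self, Function.update_of_ne (Nat.lt_succ_self x).ne]
  constructor
  · intro h
    exact (h []).resolve_left fun h => h fun w => by simp
  · intro h u
    rcases List.eq_nil_or_concat u with rfl | ⟨w, d, rfl⟩
    · exact Or.inr h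
    · left
      intro h
      apply h w
      cases d <;> simp

theorem everywhere (h : Definable Φ) : Definable fun _ env => ∀ u, Φ u env := fun g x => by
  obtain ⟨φ, hφ⟩ := h g x
  exact ⟨.all₁ x φ, fun v V => by simp [S2S.Sat, hφ]⟩

theorem reindex {κ : Type} (f : ι → κ) (h : Definable Φ) :
    Definable fun u (env : κ → Set (List Bool)) => Φ u fun i => env (f i) :=
  fun g x => h (fun i => g (f i)) x

theorem allSets {β : Type} [Finite ι] [Finite β]
    {Φ : List Bool → (ι ⊕ β → Set (List Bool)) → Prop} (h : Definable Φ) :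
    Definable fun u env => ∀ X : β → Set (List Bool), Φ u (Sum.elim env X) := fun g x => by
  have : Fintype β := Fintype.ofFinite β
  obtain ⟨M, hM⟩ := (Set.finite_range g).bddAbove
  obtain ⟨k, ⟨e⟩⟩ := Finite.exists_equiv_fin β
  let f : β → ℕ := fun b => M + 1 + e b
  have hf : Function.Injective f := fun a b hab =>
    e.injective (Fin.ext (by simpa [f] using hab))
  have hfg : ∀ i b, g i ≠ f b := fun i b hib => by
    have := hM (Set.mem_range_self i)
    simp only [f] at hib
    omega
  obtain ⟨φ, hφ⟩ := h (Sum.elim g f) x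
  let l : List ℕ := Finset.univ.toList.map f
  have hl : ∀ n, n ∈ l ↔ ∃ b, f b = n := fun n => by simp [l]
  refine ⟨S2S.allList l φ, fun v V => ?_⟩
  simp only [S2S.sat_allList, hφ]
  constructor
  · intro h X
    classical
    let V' : ℕ → Set (List Bool) := fun n => if hn : ∃ b, f b = n then X hn.choose else V n
    have h1 : ∀ b, V' (f b) = X b := fun b => by
      have hn : ∃ b', f b' = f b := ⟨b, rfl⟩
      simp only [V', dif_pos hn, hf hn.choose_spec]
    have h2 : ∀ n ∉ l, V' n = V n := fun n hn => dif_neg fun h => hn ((hl n).2 h)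
    convert h V' h2 using 2 with i
    rcases i with i | b
    · exact (h2 _ fun hi => by obtain ⟨b, hb⟩ := (hl _).1 hi; exact hfg i b hb.symm).symm
    · exact (h1 b).symm
  · intro h V' hV
    convert h (fun b => V' (f b)) using 2 with i
    rcases i with i | b
    · exact hV _ fun hi => by obtain ⟨b, hb⟩ := (hl _).1 hi; exact hfg i b hb.symm
    · rfl

end Definable

/-- Definability of a set of pairs `(u, q)` that depends on sets of vertices. -/
def DefinableSet {ι Q : Type} (D : (ι → Set (List Bool)) → Set (List Bool × Q)) : Prop :=
  ∀ q, Definable fun u env => (u, q) ∈ D env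

/-- Fixpoints are definable: a postfixpoint is a `Q`-indexed family of sets of vertices. -/
theorem DefinableSet.nuSet {ι Q : Type} [Finite ι] [Finite Q]
    {Γ : (ι → Set (List Bool)) → Set (List Bool × Q) → Set (List Bool × Q)}
    (h : DefinableSet fun env : ι ⊕ Q → Set (List Bool) =>
      Γ (fun i => env (.inl i)) {v | v.1 ∈ env (.inr v.2)}) :
    DefinableSet fun env => _root_.nuSet (Γ env) := by
  intro q
  have h1 : Definable fun u (env : ι ⊕ Q → Set (List Bool)) =>
      ((∀ w, ∀ q', w ∈ env (.inr q') →
        (w, q') ∈ Γ (fun i => env (.inl i)) {v | v.1 ∈ env (.inr v.2)}) ∧ u ∈ env (.inr q)) :=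
    (Definable.everywhere (Definable.all fun q' => (Definable.mem (.inr q')).imp (h q'))).and
      (Definable.mem (.inr q))
  refine h1.not.allSets.not.congr fun u env => ?_
  simp only [not_forall, not_not, Sum.elim_inl, Sum.elim_inr]
  constructor
  · rintro ⟨X, hX, hu⟩
    exact ⟨fun q' => {w | (w, q') ∈ X}, fun w q' hw => hX hw, hu⟩
  · rintro ⟨X, hX, hu⟩
    exact ⟨{v | v.1 ∈ X v.2}, fun v hv => hX v.1 v.2 hv, hu⟩

namespace AltAutomaton

variable {S Q : Type}

/-- The one-round operator of the acceptance game, with the tree given by the sets `env (l a)` of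
the vertices that have the label `a`. -/
def envPre {ι : Type} (A : AltAutomaton S Q) (l : S → ι) (env : ι → Set (List Bool)) (P : Bool)
    (Z : Set (List Bool × Q)) : Set (List Bool × Q) :=
  {v | ∃ a, v.1 ∈ env (l a) ∧
    (A.trans v.2 a).Force P fun x => (v.1 ++ [x.1], x.2) ∈ Z}

theorem envPre_eq {ι : Type} (A : AltAutomaton S Q) (l : S → ι) {env : ι → Set (List Bool)}
    {t : LabeledTree S} (h : ∀ a, env (l a) = {u | t u = a}) : A.envPre l env = A.pre t := by
  funext P Z
  ext v
  simp [envPre, pre, h]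

theorem definable_force {ι : Type} {Z : (ι → Set (List Bool)) → Set (List Bool × Q)}
    (hZ : DefinableSet Z) (P : Bool) (e : PosExpr (Bool × Q)) :
    Definable fun u env => e.Force P fun x => (u ++ [x.1], x.2) ∈ Z env := by
  induction e with
  | atom x => exact ((hZ x.2).child x.1).congr fun _ _ => by cases P <;> exact Iff.rfl
  | and e₁ e₂ h1 h2 =>
    cases P
    · exact h1.or h2
    · exact h1.and h2
  | or e₁ e₂ h1 h2 =>
    cases P
    · exact h1.and h2
    · exact h1.or h2

theorem definableSet_envPre {ι : Type} [Finite S] (A : AltAutomaton S Q) (l : S → ι) (P : Bool)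
    {Z : (ι → Set (List Bool)) → Set (List Bool × Q)} (hZ : DefinableSet Z) :
    DefinableSet fun env => A.envPre l env P (Z env) :=
  fun q => Definable.ex fun a => (Definable.mem (l a)).and (definable_force hZ P (A.trans q a))

theorem definableSet_winRegion [Finite S] [Finite Q] [DecidableEq Q] (A : AltAutomaton S Q)
    (n : ℕ) :
    ∀ {ι : Type} [Finite ι] (l : S → ι) (P : Bool) (K : Finset Q)
      {D T : (ι → Set (List Bool)) → Set (List Bool × Q)}, DefinableSet D → DefinableSet T →
      DefinableSet fun env =>
        winRegion (A.envPre l env) Prod.snd A.muller n P K (D env) (T env) := by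
  induction n with
  | zero => exact fun _ _ _ _ _ _ _ _ => Definable.const False
  | succ n ih =>
    intro ι _ l P K
    have key : ∀ (P : Bool) {D T : (ι → Set (List Bool)) → Set (List Bool × Q)},
        DefinableSet D → DefinableSet T →
        DefinableSet fun env => nuSet (recurStep (winRegion (A.envPre l env) Prod.snd A.muller n P)
          (A.envPre l env P) Prod.snd K (D env) (T env)) := by
      intro P D T hD hT
      refine DefinableSet.nuSet fun q => ?_
      have hD' : DefinableSet fun env : ι ⊕ Q → Set (List Bool) => D fun i => env (.inl i) :=
        fun q => (hD q).reindex Sum.inl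
      have hT' : DefinableSet fun env : ι ⊕ Q → Set (List Bool) => T fun i => env (.inl i) :=
        fun q => (hT q).reindex Sum.inl
      have hY : ∀ c, DefinableSet fun env : ι ⊕ Q → Set (List Bool) =>
          colorPre (A.envPre l (fun i => env (.inl i)) P) Prod.snd (D fun i => env (.inl i)) c
            ({v | v.1 ∈ env (.inr v.2)} ∪ T fun i => env (.inl i)) := fun c q =>
        (hD' q).and ((Definable.const (q = c)).and
          (definableSet_envPre A (fun a => Sum.inl (l a)) P
            (fun q => (Definable.mem (.inr q)).or (hT' q)) q))
      refine (hD' q).and (Definable.all fun c => (Definable.const (c ∈ K)).imp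
        ((hY c q).or (ih (fun a => Sum.inl (l a)) P (K.erase c) ?_ ?_ q)))
      · exact fun q => (hD' q).and (Definable.const (q ≠ c))
      · exact fun q => (hT' q).or (hY c q)
    intro D T hD hT q
    exact ((Definable.const ((K : Set Q) ∈ A.muller ↔ P = true)).and (key P hD hT q)).or
      ((Definable.const (¬ ((K : Set Q) ∈ A.muller ↔ P = true))).and ((hD q).and
        (key (!P) hD (fun q => ((hD q).or (hT q)).not) q).not))

/-- The languages of alternating Muller automata are regular. -/
theorem isRegular_language [Finite S] [Finite Q] (A : AltAutomaton S Q) :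
    IsRegularTreeLanguage A.language := by
  classical
  have : Fintype Q := Fintype.ofFinite Q
  obtain ⟨k, ⟨e⟩⟩ := Finite.exists_equiv_fin S
  have hdef := (A.definableSet_winRegion (Fintype.card Q) (fun a : S => a) true Finset.univ
    (D := fun _ => Set.univ) (T := fun _ => ∅) (fun _ => Definable.const True)
    (fun _ => Definable.const False) A.init).atRoot
  obtain ⟨φ, hφ⟩ := hdef (fun a => (e a : ℕ)) 0
  refine ⟨φ, fun a => e a, fun a b hab => e.injective (Fin.ext hab), fun t v V hV => ?_⟩
  rw [hφ]
  dsimp only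
  rw [A.envPre_eq (fun a => a) (t := t) hV]
  exact (A.ensures_iff_mem_language t).1

end AltAutomaton

/-! ### Chains of stages and comeager sets -/

/-- One half of the Banach–Mazur theorem. If from each stage `z`, densely in the clopen set `K z`,
one can pass to a next stage, then for all points of `K z₀` up to a meager set there is an infinite
chain of stages whose sets contain the point. As there are countably many stages, the chain can be
built by always passing to the first possible next stage, which is a locally constant choice. -/
theorem isMeagre_diff_chain {X Z : Type} [TopologicalSpace X] [Countable Z] {K : Z → Set X}
    (hK : ∀ z, IsClopen (K z)) (r : Z → Z → Prop)
    (hr : ∀ z, ∀ x ∈ K z, ∀ U, IsOpen U → x ∈ U → ∃ y ∈ U, y ∈ K z ∧ ∃ z', r z z' ∧ y ∈ K z')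
    (z₀ : Z) :
    IsMeagre (K z₀ \ {x | ∃ c : ℕ → Z, c 0 = z₀ ∧ ∀ k, r (c k) (c (k + 1)) ∧ x ∈ K (c k)}) := by
  obtain ⟨f, hf⟩ := Countable.exists_injective_nat Z
  let First : X → Z → Z → Prop := fun x z z' =>
    (r z z' ∧ x ∈ K z') ∧ ∀ z'', f z'' < f z' → ¬ (r z z'' ∧ x ∈ K z'')
  let Reach : ℕ → X → Z → Prop := fun k => k.rec (fun _ z => z = z₀)
    fun _ R x z' => ∃ z, R x z ∧ First x z z'
  have hsucc : ∀ k x z', Reach (k + 1) x z' ↔ ∃ z, Reach k x z ∧ First x z z' :=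
    fun _ _ _ => Iff.rfl
  have huniq : ∀ k x z z', Reach k x z → Reach k x z' → z = z' := by
    intro k x
    induction k with
    | zero => exact fun z z' h h' => h.trans h'.symm
    | succ k ih =>
      rintro z z' ⟨w, hw, h1, h2⟩ ⟨w', hw', h1', h2'⟩
      obtain rfl := ih _ _ hw hw'
      apply hf
      by_contra hne
      rcases lt_or_gt_of_ne hne with h | h
      · exact h2' _ h h1
      · exact h2 _ h h1'
  have hopen : ∀ k z, IsOpen {x | Reach k x z} := by
    intro k
    induction k with
    | zero => exact fun z => isOpen_const
    | succ k ih =>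
      intro z'
      have : {x | Reach (k + 1) x z'} = ⋃ z, {x | Reach k x z} ∩ ({x | r z z'} ∩ K z' ∩
          ⋂ z'' ∈ {w | f w < f z'}, {x | ¬ (r z z'' ∧ x ∈ K z'')}) := by
        ext x
        simp only [hsucc, First, Set.mem_ofPred_eq, Set.mem_iUnion, Set.mem_inter_iff,
          Set.mem_iInter]
      rw [this]
      refine isOpen_iUnion fun z => (ih z).inter ((isOpen_const.inter (hK z').2).inter ?_)
      refine Set.Finite.isOpen_biInter ?_ fun z'' _ => ?_
      · exact (Set.finite_Iio (f z')).preimage hf.injOn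
      · by_cases h : r z z''
        · simp only [h, true_and]
          exact (hK z'').1.isOpen_compl
        · simp [h]
  have hmem : ∀ k x z, x ∈ K z₀ → Reach k x z → x ∈ K z := by
    intro k x z hx h
    cases k with
    | zero => exact (show z = z₀ from h) ▸ hx
    | succ k =>
      obtain ⟨w, _, h, _⟩ := h
      exact h.2
  let O : ℕ → Set X := fun k => (⋃ z, {x | Reach k x z}) ∪ (K z₀)ᶜ
  have hO : ∀ k, O k ∈ residual X := by
    intro k
    refine residual_of_dense_open
      ((isOpen_iUnion (hopen k)).union (hK z₀).1.isOpen_compl) (dense_iff_inter_open.2 ?_)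
    rintro U hU ⟨x, hx⟩
    by_cases hx₀ : x ∈ K z₀
    · have key : ∃ y ∈ U, y ∈ K z₀ ∧ ∃ z, Reach k y z := by
        clear hmem huniq
        induction k with
        | zero => exact ⟨x, hx, hx₀, z₀, rfl⟩
        | succ k ih =>
          obtain ⟨y, hy, hy₀, z, hz⟩ := ih
          have hyz : y ∈ K z := by
            cases k with
            | zero => exact (show z = z₀ from hz) ▸ hy₀
            | succ k =>
              obtain ⟨w, _, h, _⟩ := hz
              exact h.2
          obtain ⟨y', ⟨⟨hy', hy₀'⟩, hz'⟩, -, z', hz1, hz2⟩ := hr z y hyz _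
            ((hU.inter (hK z₀).2).inter (hopen k z)) ⟨⟨hy, hy₀⟩, hz⟩
          classical
          have hne : ∃ n z', f z' = n ∧ r z z' ∧ y' ∈ K z' := ⟨_, z', rfl, hz1, hz2⟩
          obtain ⟨w, hw, hw'⟩ := Nat.find_spec hne
          exact ⟨y', hy', hy₀', w, z, hz', hw', fun w' hlt h =>
            Nat.find_min hne (hw ▸ hlt) ⟨w', rfl, h⟩⟩
      obtain ⟨y, hy, _, z, hz⟩ := key
      exact ⟨y, hy, Or.inl (Set.mem_iUnion.2 ⟨z, hz⟩)⟩
    · exact ⟨x, hx, Or.inr hx₀⟩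
  refine Filter.mem_of_superset (countable_iInter_mem.2 hO) ?_
  rintro x hx ⟨hx₀, hc⟩
  apply hc
  have hex : ∀ k, ∃ z, Reach k x z := fun k => by
    rcases Set.mem_iInter.1 hx k with h | h
    · exact Set.mem_iUnion.1 h
    · exact absurd hx₀ h
  choose c hcr using hex
  refine ⟨c, hcr 0, fun k => ⟨?_, hmem k x _ hx₀ (hcr k)⟩⟩
  obtain ⟨z, hz, h, _⟩ := hcr (k + 1)
  rw [huniq k x _ _ (hcr k) hz]
  exact h.1

/-- Kőnig's lemma for the full binary tree. -/
theorem exists_branch {T : Set (List Bool)} (hT : ∀ u d, u ++ [d] ∈ T → u ∈ T)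
    (hinf : ∀ k, ∃ u ∈ T, u.length = k) :
    ∃ b : ℕ → List Bool, b 0 = [] ∧ ∀ k, b k ∈ T ∧ ∃ d, b (k + 1) = b k ++ [d] := by
  have hpre : ∀ w u, u ++ w ∈ T → u ∈ T := by
    intro w
    induction w using List.reverseRecOn with
    | nil => simp
    | append_singleton w d ih =>
      intro u h
      rw [← List.append_assoc] at h
      exact ih u (hT _ _ h)
  let Deep : List Bool → Prop := fun u => ∀ k, ∃ w, u ++ w ∈ T ∧ w.length = k
  have hchild : ∀ u, Deep u → ∃ d, Deep (u ++ [d]) := by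
    intro u hu
    by_contra! hcon
    have hno : ∀ d, ∃ k, ∀ w, u ++ [d] ++ w ∈ T → w.length ≠ k := fun d => by
      have := hcon d
      simp only [Deep] at this
      push Not at this
      exact this
    choose k hk using hno
    obtain ⟨w, hw, hlen⟩ := hu (k false + k true + 1)
    cases w with
    | nil => simp at hlen
    | cons d w =>
      simp only [List.length_cons] at hlen
      have hle : k d ≤ w.length := by cases d <;> omega
      refine hk d (w.take (k d)) (hpre (w.drop (k d)) _ ?_) (by simpa using hle)
      simpa using hw
  let next : {u // Deep u} → {u // Deep u} := fun u => ⟨_, (hchild u.1 u.2).choose_spec⟩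
  let b : ℕ → {u // Deep u} := fun k => k.rec
    ⟨[], fun k => by obtain ⟨u, hu, h⟩ := hinf k; exact ⟨u, hu, h⟩⟩ fun _ u => next u
  refine ⟨fun k => (b k).1, rfl, fun k => ⟨?_, (hchild (b k).1 (b k).2).choose, rfl⟩⟩
  obtain ⟨w, hw, _⟩ := (b k).2 0
  exact hpre w _ hw

/-! ### The writing game -/

/-- A deterministic strategy with memory in the writing game on a tree `t`. In this game the
players write a second tree along a branch while they play the acceptance game of an automaton on
the pair of trees: in mode `m` it is player `m` who writes the next letter and who chooses the
next mode. A node of the strategy has an address in the tree, a state and a mode; `next n g m d`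
is the node that follows `n` when `g` is written, `m` becomes the mode and the acceptance game
moves on in direction `d`, if the strategy admits this direction. When it is the turn of the owner
of the strategy, he writes `letter n` and chooses the mode `nextMode n`. -/
structure WritingStrategy (G Q : Type) where
  Node : Type
  addr : Node → List Bool
  state : Node → Q
  mode : Node → Bool
  root : Node
  next : Node → G → Bool → Bool → Option Node
  letter : Node → G
  nextMode : Node → Bool

namespace WritingStrategy

variable {S G Q : Type}

/-- The strategy wins the writing game on `t` for player `P`: the opponent is in charge infinitely
often, and if `P` is as well, then the acceptance game is won. -/
structure Wins (w : WritingStrategy G Q) (P : Bool) (A : AltAutomaton (S × G) Q)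
    (t : LabeledTree S) : Prop where
  addr_root : w.addr w.root = []
  state_root : w.state w.root = A.init
  addr_next : ∀ {n g m d n'}, w.next n g m d = some n' → w.addr n' = w.addr n ++ [d]
  mode_next : ∀ {n g m d n'}, w.next n g m d = some n' → w.mode n' = m
  cover : ∀ n g m, (w.mode n = P → g = w.letter n ∧ m = w.nextMode n) →
    (A.trans (w.state n) (t (w.addr n), g)).Force P fun x =>
      ∃ n', w.next n g m x.1 = some n' ∧ w.state n' = x.2
  inf : ∀ x : ℕ → w.Node, (∀ i, ∃ g m d, w.next (x i) g m d = some (x (i + 1))) →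
    ∃ᶠ i in Filter.atTop, w.mode (x i) ≠ P
  good : ∀ x : ℕ → w.Node, (∀ i, ∃ g m d, w.next (x i) g m d = some (x (i + 1))) →
    (∃ᶠ i in Filter.atTop, w.mode (x i) = P) → infColors w.state x ∈ goodFor A.muller P

variable (w : WritingStrategy G Q) (P : Bool)

open Classical in
/-- The next mode, when the opponent of `P` hands over exactly on the levels in `σ`. -/
noncomputable def modeAfter (σ : Set ℕ) (n : w.Node) : Bool :=
  if w.mode n = P then w.nextMode n else if (w.addr n).length ∈ σ then P else !P

/-- The node of the strategy at the vertex `u`, if `u` is reachable, when the letters are written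
according to `L` and the opponent hands over on the levels in `σ`. -/
noncomputable def nodeAt (σ : Set ℕ) (L : w.Node → G) (u : List Bool) : Option w.Node :=
  u.foldl (fun o d => o.bind fun n => w.next n (L n) (w.modeAfter P σ n) d) (some w.root)

/-- The letters of a given tree. -/
def lettersOf (t' : LabeledTree G) (n : w.Node) : G := t' (w.addr n)

/-- Above the level `l`, the tree `t'` has the letters which the strategy writes when it is in
charge, and on the level `l` it is nowhere in charge. -/
def Matches (σ : Set ℕ) (l : ℕ) (t' : LabeledTree G) : Prop :=
  (∀ u n, u.length < l → w.nodeAt P σ (w.lettersOf t') u = some n → w.mode n = P →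
    t' u = w.letter n) ∧
  ∀ u n, u.length = l → w.nodeAt P σ (w.lettersOf t') u = some n → w.mode n ≠ P

variable {w P}

theorem nodeAt_append {σ : Set ℕ} {L : w.Node → G} {u : List Bool} {d : Bool} {n' : w.Node} :
    w.nodeAt P σ L (u ++ [d]) = some n' ↔
      ∃ n, w.nodeAt P σ L u = some n ∧ w.next n (L n) (w.modeAfter P σ n) d = some n' := by
  simp [nodeAt, List.foldl_append, Option.bind_eq_some_iff]

variable {A : AltAutomaton (S × G) Q} {t : LabeledTree S}

theorem Wins.addr_eq (h : w.Wins P A t) {σ : Set ℕ} {L : w.Node → G} {u : List Bool}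
    {n : w.Node} (hn : w.nodeAt P σ L u = some n) : w.addr n = u := by
  induction u using List.reverseRecOn generalizing n with
  | nil =>
    obtain rfl : w.root = n := by simpa [nodeAt] using hn
    exact h.addr_root
  | append_singleton u d ih =>
    obtain ⟨m, hm, hn⟩ := nodeAt_append.1 hn
    rw [h.addr_next hn, ih hm]

/-- The node at `u` depends only on the levels above `u`. -/
theorem Wins.nodeAt_congr (h : w.Wins P A t) {σ σ' : Set ℕ} {L L' : w.Node → G}
    {u : List Bool} (hσ : ∀ i < u.length, i ∈ σ ↔ i ∈ σ')
    (hL : ∀ v n, v.length < u.length → w.nodeAt P σ L v = some n → L n = L' n) :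
    w.nodeAt P σ L u = w.nodeAt P σ' L' u := by
  induction u using List.reverseRecOn with
  | nil => rfl
  | append_singleton u d ih =>
    simp only [List.length_append, List.length_singleton] at hσ hL
    have ih' := ih (fun i hi => hσ i (by omega)) fun v n hv => hL v n (by omega)
    ext n'
    simp only [nodeAt_append, ← ih']
    refine exists_congr fun n => and_congr_right fun hn => ?_
    have ha := h.addr_eq hn
    have hm : w.modeAfter P σ n = w.modeAfter P σ' n := by
      classical
      exact if_congr Iff.rfl rfl
        (if_congr (by rw [ha]; exact hσ u.length (by omega)) rfl rfl)
    rw [hL u n (by omega) hn, hm]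

theorem Wins.matches_congr (h : w.Wins P A t) {σ σ' : Set ℕ} {l : ℕ} {t' t'' : LabeledTree G}
    (hσ : ∀ i < l, i ∈ σ ↔ i ∈ σ') (ht : ∀ u, u.length < l → t' u = t'' u)
    (hm : w.Matches P σ l t') : w.Matches P σ' l t'' := by
  have key : ∀ u, u.length ≤ l →
      w.nodeAt P σ (w.lettersOf t') u = w.nodeAt P σ' (w.lettersOf t'') u := fun u hu =>
    h.nodeAt_congr (fun i hi => hσ i (by omega)) fun v n hv hn =>
      ht _ (by rw [h.addr_eq hn]; omega)
  constructor
  · intro u n hu hn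
    rw [← key u hu.le] at hn
    rw [← ht u hu]
    exact hm.1 u n hu hn
  · intro u n hu hn
    rw [← key u hu.le] at hn
    exact hm.2 u n hu hn

/-- As long as the opponent does not hand over, he stays in charge. -/
theorem Wins.mode_ne_of_append (h : w.Wins P A t) {σ : Set ℕ} {L : w.Node → G} {u : List Bool}
    {d : Bool} {n n' : w.Node} (hu : u.length ∉ σ) (hn : w.nodeAt P σ L u = some n)
    (hn' : w.nodeAt P σ L (u ++ [d]) = some n') (hm : w.mode n ≠ P) : w.mode n' ≠ P := by
  obtain ⟨n₁, h₁, h₂⟩ := nodeAt_append.1 hn'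
  obtain rfl : n = n₁ := Option.some.inj (hn.symm.trans h₁)
  rw [h.mode_next h₂]
  simp [modeAfter, hm, h.addr_eq hn, hu]

/-- The successive nodes along a branch form a play of the writing game. -/
theorem nodeAt_branch {σ : Set ℕ} {L : w.Node → G} {b : ℕ → List Bool}
    (hb : ∀ k, ∃ d, b (k + 1) = b k ++ [d]) {x : ℕ → w.Node}
    (hx : ∀ k, w.nodeAt P σ L (b k) = some (x k)) (k : ℕ) :
    ∃ g m d, w.next (x k) g m d = some (x (k + 1)) := by
  obtain ⟨d, hd⟩ := hb k
  obtain ⟨n, hn, hn'⟩ := nodeAt_append.1 (hd ▸ hx (k + 1))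
  obtain rfl : n = x k := Option.some.inj (hn.symm.trans (hx k))
  exact ⟨_, _, _, hn'⟩

/-- A tree can be changed from some level on so that it has the letters which the strategy writes
until, by Kőnig's lemma, the opponent is in charge again on a whole level. -/
theorem Wins.exists_matches (h : w.Wins P A t) {σ : Set ℕ} {l : ℕ} (hσ : ∀ i ∈ σ, i < l)
    {t' : LabeledTree G}
    (ht' : ∀ u n, u.length < l → w.nodeAt P σ (w.lettersOf t') u = some n → w.mode n = P →
      t' u = w.letter n) :
    ∃ t'' : LabeledTree G, (∀ u, u.length < l → t'' u = t' u) ∧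
      ∃ l' ≥ l, w.Matches P σ l' t'' := by
  classical
  -- the new letters depend on the node at the vertex, which depends on the letters above only
  let L : w.Node → G := fun n => if (w.addr n).length < l then t' (w.addr n) else w.letter n
  let t'' : LabeledTree G := fun u => (w.nodeAt P σ L u).elim (t' u) L
  have hsome : ∀ u n, w.nodeAt P σ L u = some n → t'' u = L n := fun u n hn => by
    simp [t'', hn]
  have hlow : ∀ u, u.length < l → t'' u = t' u := by
    intro u hu
    cases hn : w.nodeAt P σ L u with
    | none => simp [t'', hn]
    | some n => rw [hsome u n hn]; simp [L, h.addr_eq hn, hu]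
  have hnode : ∀ u, w.nodeAt P σ L u = w.nodeAt P σ (w.lettersOf t'') u := fun u =>
    h.nodeAt_congr (fun _ _ => Iff.rfl) fun v n _ hn => by
      rw [lettersOf, h.addr_eq hn, hsome v n hn]
  have hnode' : ∀ u, u.length ≤ l →
      w.nodeAt P σ L u = w.nodeAt P σ (w.lettersOf t') u := fun u hu =>
    h.nodeAt_congr (fun _ _ => Iff.rfl) fun v n hv hn => by
      simp only [L, lettersOf, h.addr_eq hn]
      rw [if_pos (by omega)]
  have hletters : ∀ u n, w.nodeAt P σ L u = some n → w.mode n = P → t'' u = w.letter n := by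
    intro u n hn hm
    by_cases hu : u.length < l
    · rw [hlow u hu]
      exact ht' u n hu (hnode' u hu.le ▸ hn) hm
    · rw [hsome u n hn]
      simp [L, h.addr_eq hn, hu]
  refine ⟨t'', hlow, ?_⟩
  -- otherwise there is a branch on which the strategy is in charge forever, but such plays are lost
  by_contra! hcon
  have hlevel : ∀ k ≥ l, ∃ u n, u.length = k ∧ w.nodeAt P σ L u = some n ∧ w.mode n = P := by
    intro k hk
    by_contra! hno
    refine hcon k hk ⟨fun u n _ hn => hletters u n (hnode u ▸ hn), fun u n hu hn => ?_⟩
    exact hno u n hu (hnode u ▸ hn)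
  let T : Set (List Bool) :=
    {u | ∃ n, w.nodeAt P σ L u = some n ∧ (l ≤ u.length → w.mode n = P)}
  have hTmem : ∀ u, u ∈ T ↔
      ∃ n, w.nodeAt P σ L u = some n ∧ (l ≤ u.length → w.mode n = P) := fun _ => Iff.rfl
  have hT : ∀ u d, u ++ [d] ∈ T → u ∈ T := by
    intro u d hu
    obtain ⟨n', hn', hm'⟩ := (hTmem _).1 hu
    obtain ⟨n, hn, _⟩ := nodeAt_append.1 hn'
    refine (hTmem _).2 ⟨n, hn, fun hlu => ?_⟩
    by_contra hm
    refine h.mode_ne_of_append (fun hi => ?_) hn hn' hm (hm' ?_)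
    · have := hσ _ hi
      omega
    · simp
      omega
  have hTinf : ∀ k, ∃ u ∈ T, u.length = k := by
    have hdown : ∀ j k, (∃ u ∈ T, u.length = k + j) → ∃ u ∈ T, u.length = k := by
      intro j
      induction j with
      | zero => exact fun k h => h
      | succ j ih =>
        rintro k ⟨u, hu, hlen⟩
        rcases List.eq_nil_or_concat u with rfl | ⟨v, d, rfl⟩
        · simp at hlen
        · refine ih k ⟨v, hT v d (by simpa using hu), ?_⟩
          simp at hlen
          omega
    intro k
    obtain ⟨u, n, hu, hn, hm⟩ := hlevel (k + l) (by omega)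
    exact hdown l k ⟨u, ⟨n, hn, fun _ => hm⟩, hu⟩
  obtain ⟨b, hb0, hb⟩ := exists_branch hT hTinf
  have hlen : ∀ k, (b k).length = k := by
    intro k
    induction k with
    | zero => simp [hb0]
    | succ k ih =>
      obtain ⟨d, hd⟩ := (hb k).2
      simp [hd, ih]
  choose x hx hxm using fun k => (hTmem _).1 (hb k).1
  have hinf := h.inf x (nodeAt_branch (fun k => (hb k).2) hx)
  refine hinf (Filter.eventually_atTop.2 ⟨l, fun k hk => not_not.2 (hxm k ?_)⟩)
  rw [hlen]
  exact hk

/-- If the mode changes infinitely often on `t'`, then the strategy wins the acceptance game. -/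
theorem Wins.ensures_pair (h : w.Wins P A t) {σ : Set ℕ} (hσ : σ.Infinite) {t' : LabeledTree G}
    (hm : ∀ k, ∃ l ≥ k, w.Matches P σ l t') :
    Ensures (A.pre (t.pair t') P) Prod.snd (goodFor A.muller P) Set.univ ∅ ([], A.init) := by
  let N := {p : List Bool × w.Node // w.nodeAt P σ (w.lettersOf t') p.1 = some p.2}
  refine ⟨⟨N, fun p => (p.1.1, w.state p.1.2), fun p p' => ∃ d, p'.1.1 = p.1.1 ++ [d],
    ⟨([], w.root), rfl⟩⟩, ?_, fun _ => Or.inl (Set.mem_univ _), ?_, ?_⟩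
  · exact Prod.ext rfl h.state_root
  · rintro ⟨⟨u, n⟩, hn⟩ -
    have hn' : w.nodeAt P σ (w.lettersOf t') u = some n := hn
    have haddr := h.addr_eq hn'
    obtain ⟨l, hl, hml⟩ := hm (u.length + 1)
    have hcov := h.cover n (t' u) (w.modeAfter P σ n) fun hmode =>
      ⟨hml.1 u n (by omega) hn' hmode, by simp [modeAfter, hmode]⟩
    rw [haddr] at hcov
    refine PosExpr.Force.mono ?_ hcov
    rintro ⟨d, q⟩ ⟨n₁, hnext, hq⟩
    refine ⟨⟨(u ++ [d], n₁), nodeAt_append.2 ⟨n, hn', ?_⟩⟩, ⟨d, rfl⟩, Prod.ext rfl hq⟩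
    rw [lettersOf, haddr]
    exact hnext
  · intro y _ hy
    have hlen : ∀ k, (y k).1.1.length = (y 0).1.1.length + k := by
      intro k
      induction k with
      | zero => rfl
      | succ k ih =>
        obtain ⟨d, hd⟩ := hy k
        rw [hd, List.length_append, ih]
        rfl
    -- the strategy is in charge infinitely often because of the levels in `σ`
    refine h.good (fun k => (y k).1.2) (nodeAt_branch hy fun k => (y k).2) ?_
    refine Filter.frequently_atTop.2 fun a => ?_
    obtain ⟨i, hi, hai⟩ := hσ.exists_gt ((y 0).1.1.length + a)
    -- on level `i` player `P` is in charge already, or the opponent hands over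
    obtain ⟨k, hk⟩ : ∃ k, i = (y 0).1.1.length + k := ⟨i - (y 0).1.1.length, by omega⟩
    by_cases hmode : w.mode (y k).1.2 = P
    · exact ⟨k, by omega, hmode⟩
    · refine ⟨k + 1, by omega, ?_⟩
      obtain ⟨d, hd⟩ := hy k
      obtain ⟨n, hn, hn'⟩ := nodeAt_append.1 (hd ▸ (y (k + 1)).2)
      obtain rfl : n = (y k).1.2 := Option.some.inj (hn.symm.trans (y k).2)
      have hmem : (w.addr (y k).1.2).length ∈ σ := by
        rw [h.addr_eq (y k).2, hlen k, ← hk]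
        exact hi
      rw [h.mode_next hn', modeAfter, if_neg hmode, if_pos hmem]

end WritingStrategy

/-! ### Winning the acceptance game on generic trees -/

section Topology

variable {S G Q : Type} [TopologicalSpace G]

theorem exists_level_of_isOpen {U : Set (LabeledTree G)} (hU : IsOpen U) {t : LabeledTree G}
    (ht : t ∈ U) : ∃ l, ∀ t' : LabeledTree G, (∀ u, u.length < l → t' u = t u) → t' ∈ U := by
  obtain ⟨I, V, hV, hI⟩ := isOpen_pi_iff.1 hU t ht
  refine ⟨I.sup List.length + 1, fun t' h => hI fun u hu => ?_⟩
  rw [h u (Nat.lt_succ_of_le (Finset.le_sup (f := List.length) hu))]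
  exact (hV u hu).2

variable [DiscreteTopology G]

/-- A set of trees that depends only on the labels above some level is clopen. -/
theorem isClopen_of_levels {K : Set (LabeledTree G)} (l : ℕ)
    (hK : ∀ t t' : LabeledTree G, (∀ u, u.length < l → t u = t' u) → t ∈ K → t' ∈ K) :
    IsClopen K := by
  have : Finite {u : List Bool // u.length < l} := (List.finite_length_lt Bool l).to_subtype
  let f : LabeledTree G → {u : List Bool // u.length < l} → G := fun t u => t u.1
  have hf : Continuous f := continuous_pi fun u => continuous_apply u.1
  have : K = f ⁻¹' (f '' K) := by
    ext t
    refine ⟨fun h => ⟨t, h, rfl⟩, ?_⟩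
    rintro ⟨t', ht', hft⟩
    exact hK t' t (fun u hu => congrFun hft ⟨u, hu⟩) ht'
  rw [this]
  exact (isClopen_discrete _).preimage hf

namespace WritingStrategy

variable {w : WritingStrategy G Q} {P : Bool} {A : AltAutomaton (S × G) Q} {t : LabeledTree S}

/-- A winning strategy of player `P` in the writing game makes `P` win the acceptance game on
`(t, t')` for all trees `t'` in a nonempty open set, up to a meager set. A stage consists of the
levels on which the opponent has handed over so far and of a level on which he is in charge
everywhere. -/
theorem Wins.isMeagre_diff [Nonempty G] (h : w.Wins P A t) :
    ∃ U : Set (LabeledTree G), IsOpen U ∧ U.Nonempty ∧ (w.mode w.root ≠ P → U = Set.univ) ∧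
      IsMeagre (U \ {t' | t.pair t' ∈ A.language ↔ P = true}) := by
  -- the stage `(l, σ)` has the points for which the opponent is in charge on level `l`
  let K : ℕ × Finset ℕ → Set (LabeledTree G) := fun z =>
    {t' | (∀ i ∈ z.2, i < z.1) ∧ w.Matches P (z.2 : Set ℕ) z.1 t'}
  have hmemK : ∀ z t', t' ∈ K z ↔ (∀ i ∈ z.2, i < z.1) ∧ w.Matches P (z.2 : Set ℕ) z.1 t' :=
    fun _ _ => Iff.rfl
  let r : ℕ × Finset ℕ → ℕ × Finset ℕ → Prop := fun z z' =>
    ∃ j ≥ z.1, z'.2 = insert j z.2 ∧ j < z'.1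
  have hK : ∀ z, IsClopen (K z) := fun z => isClopen_of_levels z.1 fun t₁ t₂ h12 h1 =>
    ⟨h1.1, h.matches_congr (fun _ _ => Iff.rfl) h12 h1.2⟩
  have hr : ∀ z, ∀ x ∈ K z, ∀ U, IsOpen U → x ∈ U →
      ∃ y ∈ U, y ∈ K z ∧ ∃ z', r z z' ∧ y ∈ K z' := by
    rintro ⟨l, σ⟩ t₁ ⟨hσ, hm⟩ U hU ht₁
    dsimp only at hσ hm
    obtain ⟨l₁, hl₁⟩ := exists_level_of_isOpen hU ht₁
    -- handing over on level `j` leaves the labels up to level `l₁` as they are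
    let j := max l l₁
    have hlj : l ≤ j := le_max_left _ _
    have hσ' : ∀ i < j, i ∈ ((insert j σ : Finset ℕ) : Set ℕ) ↔ i ∈ (σ : Set ℕ) := by
      intro i hi
      simp [hi.ne]
    -- the decisions before level `j`, and hence the nodes, are unaffected by the insertion of `j`
    have hm' : w.Matches P ((insert j σ : Finset ℕ) : Set ℕ) l t₁ :=
      h.matches_congr (fun i hi => (hσ' i (by omega)).symm) (fun _ _ => rfl) hm
    -- from level `l` to level `j` the opponent stays in charge
    have hstay : ∀ u n, l ≤ u.length → u.length ≤ j →
        w.nodeAt P ((insert j σ : Finset ℕ) : Set ℕ) (w.lettersOf t₁) u = some n →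
        w.mode n ≠ P := by
      intro u
      induction u using List.reverseRecOn with
      | nil => exact fun n hu _ hn => hm'.2 _ n (by simpa using (hu.antisymm (Nat.zero_le _)).symm) hn
      | append_singleton u d ih =>
        intro n' hu hu' hn'
        by_cases hul : (u ++ [d]).length = l
        · exact hm'.2 _ n' hul hn'
        · simp only [List.length_append, List.length_singleton] at hu hu' hul
          obtain ⟨n, hn, _⟩ := nodeAt_append.1 hn'
          refine h.mode_ne_of_append ?_ hn hn' (ih n (by omega) (by omega) hn)
          intro hi
          have := hσ _ ((hσ' _ (by omega)).1 hi)
          omega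
    have hlt : ∀ i ∈ ((insert j σ : Finset ℕ) : Set ℕ), i < j + 1 := by
      intro i hi
      rcases Finset.mem_insert.1 (Finset.mem_coe.1 hi) with hi | hi
      · omega
      · have := hσ i hi
        omega
    have hletter : ∀ u n, u.length < j + 1 →
        w.nodeAt P ((insert j σ : Finset ℕ) : Set ℕ) (w.lettersOf t₁) u = some n →
        w.mode n = P → t₁ u = w.letter n := by
      intro u n hu hn hmode
      by_cases hul : u.length < l
      · exact hm'.1 u n hul hn hmode
      · exact absurd hmode (hstay u n (by omega) (by omega) hn)
    obtain ⟨t₂, h12, l', hl', hm₂⟩ := h.exists_matches hlt hletter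
    refine ⟨t₂, hl₁ t₂ fun u hu => h12 u ?_, ⟨hσ, h.matches_congr (fun _ _ => Iff.rfl) ?_ hm⟩,
      (l', insert j σ), ⟨j, hlj, rfl, hl'⟩, ?_, hm₂⟩
    · have : l₁ ≤ j := le_max_right _ _
      omega
    · exact fun u hu => (h12 u (by omega)).symm
    · intro i hi
      rcases Finset.mem_insert.1 hi with rfl | hi
      · exact hl'
      · have := hσ i hi
        dsimp only
        omega
  have hwin : ∀ z₀ : ℕ × Finset ℕ, ∀ t', (∃ c : ℕ → ℕ × Finset ℕ, c 0 = z₀ ∧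
      ∀ k, r (c k) (c (k + 1)) ∧ t' ∈ K (c k)) → (t.pair t' ∈ A.language ↔ P = true) := by
    rintro z₀ t' ⟨c, -, hc⟩
    choose j hjl hj hjc using fun k => (hc k).1
    have hl : StrictMono fun k => (c k).1 :=
      strictMono_nat_of_lt_succ fun k => lt_of_le_of_lt (hjl k) (hjc k)
    let σ : Set ℕ := {i | ∃ k, i ∈ (c k).2}
    have hjσ : ∀ k, j k ∈ σ := fun k => ⟨k + 1, by rw [hj k]; exact Finset.mem_insert_self _ _⟩
    have hsub : ∀ k m, (c k).2 ⊆ (c (k + m)).2 := by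
      intro k m
      induction m with
      | zero => exact subset_rfl
      | succ m ih =>
        rw [← add_assoc, hj (k + m)]
        exact ih.trans (Finset.subset_insert _ _)
    have hlow : ∀ k m i, i < (c k).1 → i ∈ (c (k + m)).2 → i ∈ (c k).2 := by
      intro k m i hi
      induction m with
      | zero => exact id
      | succ m ih =>
        rw [← add_assoc, hj (k + m), Finset.mem_insert]
        rintro (rfl | him)
        · have h1 := hjl (k + m)
          have h2 : (c k).1 ≤ (c (k + m)).1 := hl.monotone (Nat.le_add_right _ _)
          omega
        · exact ih him
    -- below the level of a stage, the schedule of the stage is final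
    have hσc : ∀ k, ∀ i < (c k).1, i ∈ ((c k).2 : Set ℕ) ↔ i ∈ σ := by
      intro k i hi
      refine ⟨fun hik => ⟨k, hik⟩, ?_⟩
      rintro ⟨m, hm⟩
      rcases le_total k m with hkm | hkm
      · obtain ⟨m', rfl⟩ := Nat.exists_eq_add_of_le hkm
        exact hlow k m' i hi hm
      · obtain ⟨m', rfl⟩ := Nat.exists_eq_add_of_le hkm
        exact hsub m m' hm
    refine AltAutomaton.mem_language_iff_of_ensures
      (h.ensures_pair (σ := σ) (Set.infinite_of_forall_exists_gt fun k => ?_)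
        fun k => ⟨(c k).1, hl.le_apply, ?_⟩)
    · refine ⟨j (k + 1), hjσ _, ?_⟩
      have h1 : k + 1 ≤ (c (k + 1)).1 := hl.le_apply
      have h2 := hjl (k + 1)
      omega
    · exact h.matches_congr (hσc k) (fun _ _ => rfl) ((hmemK _ _).1 (hc k).2).2
  have hfinal : ∀ z₀, IsMeagre (K z₀ \ {t' | t.pair t' ∈ A.language ↔ P = true}) := by
    refine fun z₀ => IsMeagre.mono ?_ (isMeagre_diff_chain hK r hr z₀)
    exact fun t' ht' => ⟨ht'.1, fun hc => ht'.2 (hwin z₀ t' hc)⟩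
  by_cases hmode : w.mode w.root = P
  · obtain ⟨g⟩ := ‹Nonempty G›
    obtain ⟨t₂, -, l', -, hm₂⟩ := h.exists_matches (l := 0) (σ := ∅) (t' := fun _ => g)
      (fun i hi => absurd hi (Set.notMem_empty i)) fun u n hu => absurd hu (Nat.not_lt_zero _)
    refine ⟨K (l', ∅), (hK _).2, ⟨t₂, ?_⟩, fun hne => absurd hmode hne, hfinal _⟩
    exact (hmemK _ _).2 ⟨by simp, by simpa using hm₂⟩
  · refine ⟨Set.univ, isOpen_univ, Set.univ_nonempty, fun _ => rfl, ?_⟩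
    have huniv : K (0, ∅) = Set.univ := by
      refine Set.eq_univ_of_forall fun t' => (hmemK _ _).2 ⟨by simp, ?_, ?_⟩
      · exact fun u n hu => absurd hu (Nat.not_lt_zero _)
      · intro u n hu hn
        obtain rfl : u = [] := List.length_eq_zero_iff.1 hu
        obtain rfl : w.root = n := by simpa [nodeAt] using hn
        exact hmode
    rw [← huniv]
    exact hfinal _

end WritingStrategy

end Topology

/-- A winning strategy in the writing game with the universal player in charge first decides
whether the section of the language at `t` is comeager. -/
theorem WritingStrategy.Wins.mem_categoryQuantifier_iff {S G Q : Type} [Finite G] [Nonempty G]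
    {w : WritingStrategy G Q} {P : Bool} {A : AltAutomaton (S × G) Q} {t : LabeledTree S}
    (h : w.Wins P A t) (hroot : w.mode w.root = false) :
    t ∈ categoryQuantifier A.language ↔ P = true := by
  let _ : TopologicalSpace G := ⊥
  have : DiscreteTopology G := ⟨rfl⟩
  obtain ⟨U, hUo, hUn, hU, hm⟩ := h.isMeagre_diff
  cases P with
  | true =>
    simp only [iff_true]
    rw [hU (by simp [hroot])] at hm
    refine IsMeagre.mono ?_ hm
    intro t' ht'
    exact ⟨Set.mem_univ _, fun hl => ht' (hl.2 rfl)⟩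
  | false =>
    simp only [Bool.false_eq_true, iff_false]
    intro hc
    have hc' : IsMeagre {t' : LabeledTree G | t.pair t' ∈ A.language}ᶜ := hc
    have hUm : IsMeagre U := by
      refine IsMeagre.mono ?_ (hm.union hc')
      intro t' ht'
      by_cases hl : t.pair t' ∈ A.language
      · exact Or.inl ⟨ht', fun hiff => by simpa using hiff.1 hl⟩
      · exact Or.inr hl
    -- the opponent's set and the section would both be comeager in the nonempty open set `U`
    exact not_isMeagre_of_isOpen hUo hUn hUm

/-! ### The automaton for the category quantifier -/

namespace PosExpr

/-- The expression with its atoms renamed. -/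
def map {X Y : Type} (f : X → Y) : PosExpr X → PosExpr Y
  | .atom x => .atom (f x)
  | .and e₁ e₂ => .and (e₁.map f) (e₂.map f)
  | .or e₁ e₂ => .or (e₁.map f) (e₂.map f)

theorem force_map {X Y : Type} (f : X → Y) (P : Bool) (e : PosExpr X) (K : Y → Prop) :
    (e.map f).Force P K ↔ e.Force P fun x => K (f x) := by
  induction e with
  | atom x => cases P <;> exact Iff.rfl
  | and e₁ e₂ h1 h2 | or e₁ e₂ h1 h2 => cases P <;> simp only [map, Force, h1, h2]

/-- The expression in which player `m` picks one of the expressions in `e :: l`. -/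
def pick {X : Type} (m : Bool) (e : PosExpr X) (l : List (PosExpr X)) : PosExpr X :=
  l.foldr (AltAutomaton.ownOp m) e

theorem force_pick {X : Type} (m P : Bool) (e : PosExpr X) (l : List (PosExpr X))
    (K : X → Prop) : (pick m e l).Force P K ↔
      if m = P then ∃ e' ∈ e :: l, e'.Force P K else ∀ e' ∈ e :: l, e'.Force P K := by
  induction l with
  | nil => simp [pick]
  | cons e' l ih =>
    change (AltAutomaton.ownOp m e' (pick m e l)).Force P K ↔ _
    cases m <;> cases P <;> simp [AltAutomaton.ownOp, Force] at ih ⊢ <;> rw [ih] <;> tauto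

end PosExpr

namespace AltAutomaton

variable {S G Q K : Type}

/-- The automaton that plays the writing game. Its states are pairs of a state of `A` and a mode;
in mode `m`, player `m` picks a letter of `G` and the next mode. Player `m` loses if he is in
charge from some point on; otherwise the condition of `A` decides. The pairs are encoded as
elements of `K`, and the letters of `G` are listed in `gs`; the letter `g₀` only serves to end the
chain of choices. -/
def categoryAutomaton (A : AltAutomaton (S × G) Q) (enc : Q × Bool ≃ K) (gs : List G) (g₀ : G) :
    AltAutomaton S K where
  init := enc (A.init, false)
  trans x a :=
    let opt (g : G) (m : Bool) : PosExpr (Bool × K) :=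
      (A.trans (enc.symm x).1 (a, g)).map fun y => (y.1, enc (y.2, m))
    PosExpr.pick (enc.symm x).2 (opt g₀ false) (gs.flatMap fun g => [opt g false, opt g true])
  muller := {F | (∃ q, enc (q, false) ∈ F) ∧
    ((∃ q, enc (q, true) ∈ F) → {q | ∃ m, enc (q, m) ∈ F} ∈ A.muller)}

variable {A : AltAutomaton (S × G) Q} {enc : Q × Bool ≃ K} {gs : List G} {g₀ : G}

theorem force_categoryAutomaton (hgs : ∀ g, g ∈ gs) (x : K) (a : S) (P : Bool)
    (Z : Bool × K → Prop) :
    (((A.categoryAutomaton enc gs g₀).trans x a).Force P Z) ↔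
      if (enc.symm x).2 = P then
        ∃ g m, (A.trans (enc.symm x).1 (a, g)).Force P fun y => Z (y.1, enc (y.2, m))
      else ∀ g m, (A.trans (enc.symm x).1 (a, g)).Force P fun y => Z (y.1, enc (y.2, m)) := by
  have hall : ∀ (opt : G → Bool → PosExpr (Bool × K)) e, e ∈ opt g₀ false ::
      (gs.flatMap fun g => [opt g false, opt g true]) ↔ ∃ g m, e = opt g m := by
    intro opt e
    simp only [List.mem_cons, List.mem_flatMap, hgs, true_and, List.not_mem_nil, or_false,
      Bool.exists_bool]
    exact or_iff_right_of_imp fun h => ⟨g₀, Or.inl h⟩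
  have hopt := hall fun g m => (A.trans (enc.symm x).1 (a, g)).map fun y => (y.1, enc (y.2, m))
  simp only [categoryAutomaton, PosExpr.force_pick, hopt, ← PosExpr.force_map]
  split_ifs
  · exact ⟨fun ⟨_, ⟨g, m, h⟩, h'⟩ => ⟨g, m, h ▸ h'⟩, fun ⟨g, m, h⟩ => ⟨_, ⟨g, m, rfl⟩, h⟩⟩
  · exact ⟨fun h g m => h _ ⟨g, m, rfl⟩, fun h _ ⟨g, m, h'⟩ => h' ▸ h g m⟩

/-- The transitions of a game automaton in terms of an owner and of successor states. -/
theorem IsGame.exists_successors {A : AltAutomaton S Q} (hA : A.IsGame) :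
    ∃ (o : Q → S → Bool) (δ : Q → S → Bool → Q), ∀ q a, A.trans q a =
      ownOp (o q a) (.atom (false, δ q a false)) (.atom (true, δ q a true)) := by
  have : ∀ q a, ∃ (o : Bool) (δ : Bool → Q), A.trans q a =
      ownOp o (.atom (false, δ false)) (.atom (true, δ true)) := by
    intro q a
    obtain ⟨qL, qR, h | h⟩ := hA q a
    · exact ⟨true, fun d => bif d then qR else qL, h⟩
    · exact ⟨false, fun d => bif d then qR else qL, h⟩
  choose o δ h using this
  exact ⟨o, δ, h⟩

/-- The infinite pigeonhole principle. -/
theorem exists_color_frequently {N C : Type} [Finite C] {p : N → Prop} {col : N → C}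
    {x : ℕ → N} (h : ∃ᶠ i in Filter.atTop, p (x i)) :
    ∃ c, ∃ᶠ i in Filter.atTop, p (x i) ∧ col (x i) = c := by
  by_contra! hcon
  refine h ((Filter.eventually_all.2 hcon).mono fun i hi hp => hi (col (x i)) hp rfl)

/-- A strategy graph for the acceptance game of the automaton for the category quantifier yields a
winning strategy in the writing game. As `A` is a game automaton, the successor node is
determined by the letter, the mode and the direction. -/
theorem exists_writingStrategy [Finite Q] (hA : A.IsGame) (hgs : ∀ g, g ∈ gs)
    {P : Bool} {t : LabeledTree S}
    (h : Ensures ((A.categoryAutomaton enc gs g₀).pre t P) Prod.snd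
      (goodFor (A.categoryAutomaton enc gs g₀).muller P) Set.univ ∅ ([], enc (A.init, false))) :
    ∃ w : WritingStrategy G Q, w.Wins P A t ∧ w.mode w.root = false := by
  classical
  obtain ⟨s, hs, hwin⟩ := h
  obtain ⟨o, δ, hδ⟩ := hA.exists_successors
  let st : s.Node → Q := fun n => (enc.symm (s.pos n).2).1
  let md : s.Node → Bool := fun n => (enc.symm (s.pos n).2).2
  let Opt : s.Node → G → Bool → Prop := fun n g m =>
    (A.trans (st n) (t (s.pos n).1, g)).Force P fun y =>
      ∃ n', s.Move n n' ∧ s.pos n' = ((s.pos n).1 ++ [y.1], enc (y.2, m))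
  have hforce : ∀ n, if md n = P then ∃ g m, Opt n g m else ∀ g m, Opt n g m := fun n =>
    (force_categoryAutomaton hgs _ _ _ _).1 (hwin.step n (Set.mem_univ _))
  have hown : ∀ n, ∃ g m, md n = P → Opt n g m := by
    intro n
    have := hforce n
    by_cases hn : md n = P
    · rw [if_pos hn] at this
      obtain ⟨g, m, h⟩ := this
      exact ⟨g, m, fun _ => h⟩
    · exact ⟨g₀, false, fun h => absurd h hn⟩
  choose letter nextMode hletter using hown
  let Next : s.Node → G → Bool → Bool → s.Node → Prop := fun n g m d n' =>
    s.Move n n' ∧ s.pos n' = ((s.pos n).1 ++ [d], enc (δ (st n) (t (s.pos n).1, g) d, m))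
  let next : s.Node → G → Bool → Bool → Option s.Node := fun n g m d =>
    if h : ∃ n', Next n g m d n' then some h.choose else none
  have hnext : ∀ {n g m d n'}, next n g m d = some n' → Next n g m d n' := by
    intro n g m d n' h
    simp only [next] at h
    split_ifs at h with hex
    obtain rfl := Option.some.inj h
    exact hex.choose_spec
  have hnext' : ∀ {n g m d}, (∃ n', Next n g m d n') → ∃ n', next n g m d = some n' := by
    intro n g m d h
    exact ⟨h.choose, dif_pos h⟩
  have hcol : ∀ x : ℕ → s.Node, (∀ i, ∃ g m d, next (x i) g m d = some (x (i + 1))) →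
      infColors Prod.snd (fun i => s.pos (x i)) ∈
        goodFor (A.categoryAutomaton enc gs g₀).muller P := fun x hx =>
    hwin.inf x (fun _ => Set.mem_univ _) fun i => by
      obtain ⟨g, m, d, h⟩ := hx i
      exact (hnext h).1
  have hmem : ∀ (x : ℕ → s.Node) q m, enc (q, m) ∈ infColors Prod.snd (fun i => s.pos (x i)) ↔
      ∃ᶠ i in Filter.atTop, md (x i) = m ∧ st (x i) = q := by
    intro x q m
    refine Filter.frequently_congr (Filter.Eventually.of_forall fun i => ?_)
    rw [← Equiv.symm_apply_eq, Prod.ext_iff]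
    exact and_comm
  have hmode : ∀ (x : ℕ → s.Node) m, (∃ q, enc (q, m) ∈
      infColors Prod.snd (fun i => s.pos (x i))) ↔ ∃ᶠ i in Filter.atTop, md (x i) = m := by
    intro x m
    simp only [hmem]
    constructor
    · rintro ⟨q, h⟩
      exact h.mono fun i hi => hi.1
    · exact fun h => exists_color_frequently (p := fun n => md n = m) h
  have hstate : ∀ x : ℕ → s.Node, {q | ∃ m, enc (q, m) ∈
      infColors Prod.snd (fun i => s.pos (x i))} = infColors st x := by
    intro x
    ext q
    change (∃ m, _ ∈ infColors _ _) ↔ ∃ᶠ i in Filter.atTop, st (x i) = q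
    simp only [hmem]
    constructor
    · rintro ⟨m, h⟩
      exact h.mono fun i hi => hi.2
    · intro h
      obtain ⟨m, hm⟩ := exists_color_frequently (p := fun n => st n = q) (col := md) h
      exact ⟨m, hm.mono fun i hi => hi.symm⟩
  have hone : ∀ x : ℕ → s.Node, (∃ᶠ i in Filter.atTop, md (x i) = true) ∨
      ∃ᶠ i in Filter.atTop, md (x i) = false := by
    intro x
    rw [← Filter.frequently_or_distrib]
    exact Filter.Frequently.of_forall fun i => by cases md (x i) <;> simp
  have hgood : ∀ x : ℕ → s.Node, (∀ i, ∃ g m d, next (x i) g m d = some (x (i + 1))) →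
      (((∃ᶠ i in Filter.atTop, md (x i) = false) ∧ ((∃ᶠ i in Filter.atTop, md (x i) = true) →
        infColors st x ∈ A.muller)) ↔ P = true) := by
    intro x hx
    have := hcol x hx
    simp only [goodFor, categoryAutomaton, Set.mem_ofPred_eq, hmode] at this
    rwa [hstate] at this
  refine ⟨⟨s.Node, fun n => (s.pos n).1, st, md, s.root, next, letter, nextMode⟩, ?_, ?_⟩
  · refine ⟨by simp [hs], by simp [st, hs], fun h => ?_, fun h => ?_, ?_, ?_, ?_⟩
    · exact congrArg Prod.fst (hnext h).2
    · simp [md, (hnext h).2]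
    · intro n g m hgm
      have hopt : Opt n g m := by
        by_cases hn : md n = P
        · obtain ⟨rfl, rfl⟩ := hgm hn
          exact hletter n hn
        · have := hforce n
          rw [if_neg hn] at this
          exact this g m
      have himp : ∀ d, (∃ n', s.Move n n' ∧ s.pos n' =
          ((s.pos n).1 ++ [d], enc (δ (st n) (t (s.pos n).1, g) d, m))) →
          ∃ n', next n g m d = some n' ∧ st n' = δ (st n) (t (s.pos n).1, g) d := by
        intro d hd
        obtain ⟨n', hn'⟩ := hnext' hd
        exact ⟨n', hn', by simp [st, (hnext hn').2]⟩
      have h0 := himp false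
      have h1 := himp true
      simp only [Opt, hδ] at hopt ⊢
      generalize o (st n) (t (s.pos n).1, g) = b at hopt ⊢
      cases b <;> cases P <;> simp only [ownOp, PosExpr.Force] at hopt ⊢
      exacts [hopt.imp h0 h1, hopt.imp h0 h1, hopt.imp h0 h1, hopt.imp h0 h1]
    · intro x hx
      have hg := hgood x hx
      have h1 := hone x
      cases P with
      | true => exact (hg.2 rfl).1.mono fun i hi => by simp [show md (x i) = false from hi]
      | false =>
        simp only [Bool.false_eq_true, iff_false, not_and, Classical.not_imp] at hg
        have h2 : ∃ᶠ i in Filter.atTop, md (x i) = true := h1.elim id fun h => (hg h).1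
        exact h2.mono fun i hi => by simp [show md (x i) = true from hi]
    · intro x hx hP
      have hg := hgood x hx
      have h1 := hone x
      cases P with
      | true => simpa [goodFor] using (hg.2 rfl).2 hP
      | false =>
        simp only [Bool.false_eq_true, iff_false, not_and, Classical.not_imp] at hg
        simpa [goodFor] using (hg hP).2
  · simp [md, hs]

/-- The automaton for the category quantifier is correct. -/
theorem language_categoryAutomaton [Finite G] [Finite Q] (hA : A.IsGame) (hgs : ∀ g, g ∈ gs) :
    (A.categoryAutomaton enc gs g₀).language = categoryQuantifier A.language := by
  classical
  have : Finite K := Finite.of_equiv _ enc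
  have : Fintype K := Fintype.ofFinite K
  have : Nonempty G := ⟨g₀⟩
  ext t
  obtain ⟨P, hP⟩ := ((A.categoryAutomaton enc gs g₀).ensures_iff_mem_language t).2
  obtain ⟨w, hw, hroot⟩ := exists_writingStrategy hA hgs hP
  rw [mem_language_iff_of_ensures hP, hw.mem_categoryQuantifier_iff hroot]

end AltAutomaton

/-! ### Computing the automaton -/

namespace CategoryCode

/-- The entry of the transition table for the state number `q` and the letter number `i`. -/
def entry (T : List (List (List PosExpr.Symbol))) (q i : ℕ) : List PosExpr.Symbol :=
  (T.getD q []).getD i []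

/-- The symbol with its state number `i` replaced by the number `2 * i + μ` of the pair of the
state and the mode number `μ`. -/
def shiftSymbol (μ : ℕ) (s : PosExpr.Symbol) : PosExpr.Symbol :=
  Sum.casesOn s Sum.inl fun y => Sum.inr (y.1, 2 * y.2 + μ)

/-- The code of the transition expression for the state number `x` and the letter number `a`. -/
def transCode (m : ℕ) (T : List (List (List PosExpr.Symbol))) (x a : ℕ) : List PosExpr.Symbol :=
  ((List.range m).flatMap fun b =>
    (Sum.inl x.bodd :: (entry T x.div2 (b + m * a)).map (shiftSymbol 0)) ++
    (Sum.inl x.bodd :: (entry T x.div2 (b + m * a)).map (shiftSymbol 1))) ++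
  (entry T x.div2 (m * a)).map (shiftSymbol 0)

/-- The code of the formula that says that a state of mode number `μ` is visited infinitely
often. -/
def modeCode (k i μ : ℕ) : List MullerFormula.Symbol :=
  ((List.range k).flatMap fun q => [Sum.inl (some true), Sum.inr (2 * q + μ)]) ++
    [Sum.inr (2 * i + μ)]

/-- A symbol of the given Muller formula, with a state replaced by the disjunction of its two
copies. -/
def doubleSymbol (s : MullerFormula.Symbol) : List MullerFormula.Symbol :=
  Sum.casesOn s (fun o => [Sum.inl o])
    fun i => [Sum.inl (some true), Sum.inr (2 * i), Sum.inr (2 * i + 1)]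

/-- The presentation of the automaton for the category quantifier, computed from the numbers of
letters and the given presentation. -/
def construct (x : (ℕ × ℕ) × AutomatonCode) : AutomatonCode :=
  (x.2.1 * 2, 2 * x.2.2.1,
    (List.range (x.2.1 * 2)).map (fun y => (List.range x.1.1).map fun a =>
      transCode x.1.2 x.2.2.2.1 y a),
    Sum.inl (some false) :: (modeCode x.2.1 x.2.2.1 0 ++
      (Sum.inl (some true) :: (Sum.inl none :: (modeCode x.2.1 x.2.2.1 1 ++
        x.2.2.2.2.flatMap doubleSymbol)))))

open Primrec

theorem primrec_shiftSymbol : Primrec₂ shiftSymbol :=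
  Primrec.sumCasesOn (f := fun p : ℕ × PosExpr.Symbol => p.2) snd (sumInl.comp snd).to₂
    (sumInr.comp (Primrec.pair (fst.comp snd) (nat_add.comp
      (nat_mul.comp (const 2) (snd.comp snd)) (fst.comp fst)))).to₂

theorem primrec_map_shiftSymbol (μ : ℕ) :
    Primrec fun l : List PosExpr.Symbol => l.map (shiftSymbol μ) :=
  list_map .id (primrec_shiftSymbol.comp (const μ) snd).to₂

theorem primrec_entry : Primrec fun p : List (List (List PosExpr.Symbol)) × ℕ × ℕ =>
    entry p.1 p.2.1 p.2.2 :=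
  (list_getD []).comp ((list_getD []).comp fst (fst.comp snd)) (snd.comp snd)

theorem primrec_transCode :
    Primrec fun p : (ℕ × List (List (List PosExpr.Symbol))) × ℕ × ℕ =>
      transCode p.1.1 p.1.2 p.2.1 p.2.2 := by
  let I := (ℕ × List (List (List PosExpr.Symbol))) × ℕ × ℕ
  have hx : Primrec fun p : I × ℕ => p.1.2.1 := fst.comp (snd.comp fst)
  have he : Primrec fun p : I × ℕ => entry p.1.1.2 p.1.2.1.div2 (p.2 + p.1.1.1 * p.1.2.2) :=
    primrec_entry.comp (.pair (snd.comp (fst.comp fst)) (.pair (nat_div2.comp hx)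
      (nat_add.comp snd (nat_mul.comp (fst.comp (fst.comp fst)) (snd.comp (snd.comp fst))))))
  have he' : Primrec fun p : I => entry p.1.2 p.2.1.div2 (p.1.1 * p.2.2) :=
    primrec_entry.comp (.pair (snd.comp fst) (.pair (nat_div2.comp (fst.comp snd))
      (nat_mul.comp (fst.comp fst) (snd.comp snd))))
  have hop : Primrec fun p : I × ℕ => (Sum.inl p.1.2.1.bodd : PosExpr.Symbol) :=
    sumInl.comp (nat_bodd.comp hx)
  exact list_append.comp
    (list_flatMap (list_range.comp (fst.comp fst))
      (list_append.comp (list_cons.comp hop ((primrec_map_shiftSymbol 0).comp he))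
        (list_cons.comp hop ((primrec_map_shiftSymbol 1).comp he))).to₂)
    ((primrec_map_shiftSymbol 0).comp he')

theorem primrec_modeCode (μ : ℕ) : Primrec₂ fun k i => modeCode k i μ := by
  have hnum : Primrec fun q : ℕ => (Sum.inr (2 * q + μ) : MullerFormula.Symbol) :=
    sumInr.comp (nat_add.comp (nat_mul.comp (const 2) .id) (const μ))
  exact list_append.comp
    (list_flatMap (list_range.comp fst)
      (list_cons.comp (const (Sum.inl (some true)))
        (list_cons.comp (hnum.comp snd) (const []))).to₂)
    (list_cons.comp (hnum.comp snd) (const []))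

theorem primrec_doubleSymbol : Primrec doubleSymbol := by
  have hdouble : Primrec fun p : MullerFormula.Symbol × ℕ => 2 * p.2 :=
    nat_mul.comp (const 2) snd
  exact Primrec.sumCasesOn .id (list_cons.comp (sumInl.comp snd) (const [])).to₂
    (list_cons.comp (const (Sum.inl (some true))) (list_cons.comp (sumInr.comp hdouble)
      (list_cons.comp (sumInr.comp (succ.comp hdouble)) (const [])))).to₂

theorem computable_construct : Computable construct := by
  let I := (ℕ × ℕ) × AutomatonCode
  have hk : Primrec fun x : I => x.2.1 := fst.comp snd
  have hi : Primrec fun x : I => x.2.2.1 := fst.comp (snd.comp snd)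
  have hT : Primrec fun x : I => x.2.2.2.1 := fst.comp (snd.comp (snd.comp snd))
  have hφ : Primrec fun x : I => x.2.2.2.2 := snd.comp (snd.comp (snd.comp snd))
  have hk2 : Primrec fun x : I => x.2.1 * 2 := nat_mul.comp hk (const 2)
  refine Primrec.to_comp (.pair hk2 (.pair (nat_mul.comp (const 2) hi) (.pair ?_ ?_)))
  · have hm : Primrec fun p : (I × ℕ) × ℕ => p.1.1.1.2 := snd.comp (fst.comp (fst.comp fst))
    have hT' : Primrec fun p : (I × ℕ) × ℕ => p.1.1.2.2.2.1 := hT.comp (fst.comp fst)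
    have hya : Primrec fun p : (I × ℕ) × ℕ => (p.1.2, p.2) := .pair (snd.comp fst) snd
    have htrans : Primrec₂ fun (p : I × ℕ) (a : ℕ) => transCode p.1.1.2 p.1.2.2.2.1 p.2 a :=
      (primrec_transCode.comp (Primrec.pair (Primrec.pair hm hT') hya)).to₂
    have hn : Primrec fun p : I × ℕ => List.range p.1.1.1 :=
      list_range.comp (fst.comp (fst.comp fst))
    exact list_map (list_range.comp hk2) (list_map hn htrans).to₂
  · refine list_cons.comp (const _) (list_append.comp ((primrec_modeCode 0).comp hk hi)
      (list_cons.comp (const _) (list_cons.comp (const _) (list_append.comp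
        ((primrec_modeCode 1).comp hk hi) (list_flatMap hφ (primrec_doubleSymbol.comp snd).to₂)))))

end CategoryCode

/-! ### The computed presentation and its size -/

namespace CategoryCode

theorem map_finRange_eq_map_range {α : Type} {N : ℕ} (f : Fin N → α) (g : ℕ → α)
    (h : ∀ i : Fin N, f i = g i) : (List.finRange N).map f = (List.range N).map g := by
  rw [← List.map_coe_finRange_eq_range, List.map_map]
  exact List.map_congr_left fun i _ => h i

theorem flatMap_finRange_eq_flatMap_range {α : Type} {N : ℕ} (f : Fin N → List α)
    (g : ℕ → List α) (h : ∀ i : Fin N, f i = g i) :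
    (List.finRange N).flatMap f = (List.range N).flatMap g := by
  rw [List.flatMap_def, List.flatMap_def, map_finRange_eq_map_range f g h]

/-- The numbering of pairs of a state and a mode; the pair of the state number `i` and the mode
`μ` has the number `2 * i + μ`. -/
def modeNumbering {Q : Type} {k : ℕ} (eQ : Q ≃ Fin k) : Q × Bool ≃ Fin (k * 2) :=
  (eQ.prodCongr finTwoEquiv.symm).trans finProdFinEquiv

theorem modeNumbering_val {Q : Type} {k : ℕ} (eQ : Q ≃ Fin k) (q : Q) (μ : Bool) :
    (modeNumbering eQ (q, μ) : ℕ) = 2 * eQ q + μ.toNat := by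
  cases μ <;> simp [modeNumbering, finTwoEquiv, add_comm]

theorem code_pick {X : Type} (num : X → ℕ) (μ : Bool) (e : PosExpr (Bool × X))
    (l : List (PosExpr (Bool × X))) : (PosExpr.pick μ e l).code num =
      (l.flatMap fun e' => Sum.inl μ :: e'.code num) ++ e.code num := by
  induction l with
  | nil => rfl
  | cons e' l ih =>
    change (AltAutomaton.ownOp μ e' (PosExpr.pick μ e l)).code num = _
    cases μ <;> simp [AltAutomaton.ownOp, PosExpr.code, ih]

theorem code_map {Q : Type} {k : ℕ} (eQ : Q ≃ Fin k) (μ : Bool) (e : PosExpr (Bool × Q)) :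
    (e.map fun y => (y.1, modeNumbering eQ (y.2, μ))).code Fin.val =
      (e.code fun q => (eQ q : ℕ)).map (shiftSymbol μ.toNat) := by
  induction e with
  | atom x => simp [PosExpr.map, PosExpr.code, shiftSymbol, modeNumbering_val]
  | and e₁ e₂ h1 h2 | or e₁ e₂ h1 h2 =>
    simp [PosExpr.map, PosExpr.code, h1, h2, shiftSymbol]

theorem entry_table {k N : ℕ} (f : Fin k → Fin N → List PosExpr.Symbol) (i : Fin k) (a : Fin N) :
    entry ((List.finRange k).map fun i => (List.finRange N).map fun a => f i a) i a = f i a := by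
  simp [entry, List.getD_eq_getElem?_getD]

/-- The formula that says that some state of mode `μ` is visited infinitely often; it ends with
the state `q₀`. -/
def modeFormula {Q : Type} {k : ℕ} (eQ : Q ≃ Fin k) (q₀ : Q) (μ : Bool) :
    MullerFormula (Fin (k * 2)) :=
  (List.finRange k).foldr (fun i ψ => .or (.visit (modeNumbering eQ (eQ.symm i, μ))) ψ)
    (.visit (modeNumbering eQ (q₀, μ)))

theorem holds_modeFormula {Q : Type} {k : ℕ} (eQ : Q ≃ Fin k) (q₀ : Q) (μ : Bool)
    (F : Set (Fin (k * 2))) :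
    (modeFormula eQ q₀ μ).Holds F ↔ ∃ q, modeNumbering eQ (q, μ) ∈ F := by
  have key : ∀ l : List (Fin k), (l.foldr (fun i ψ => MullerFormula.or
      (.visit (modeNumbering eQ (eQ.symm i, μ))) ψ) (.visit (modeNumbering eQ (q₀, μ)))).Holds F ↔
      (∃ i ∈ l, modeNumbering eQ (eQ.symm i, μ) ∈ F) ∨ modeNumbering eQ (q₀, μ) ∈ F := by
    intro l
    induction l with
    | nil => simp [MullerFormula.Holds]
    | cons i l ih => simp [MullerFormula.Holds, ih, or_assoc]
  rw [modeFormula, key]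
  constructor
  · rintro (⟨i, _, h⟩ | h)
    exacts [⟨_, h⟩, ⟨_, h⟩]
  · rintro ⟨q, h⟩
    exact Or.inl ⟨eQ q, List.mem_finRange _, by simpa using h⟩

theorem code_modeFormula {Q : Type} {k : ℕ} (eQ : Q ≃ Fin k) (q₀ : Q) (μ : Bool) :
    (modeFormula eQ q₀ μ).code Fin.val = modeCode k (eQ q₀) μ.toNat := by
  have key : ∀ l : List (Fin k), (l.foldr (fun i ψ => MullerFormula.or
      (.visit (modeNumbering eQ (eQ.symm i, μ))) ψ) (.visit (modeNumbering eQ (q₀, μ)))).code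
      Fin.val = (l.flatMap fun i : Fin k => [Sum.inl (some true), Sum.inr (2 * i + μ.toNat)]) ++
        [Sum.inr (2 * eQ q₀ + μ.toNat)] := by
    intro l
    induction l with
    | nil => simp [MullerFormula.code, modeNumbering_val]
    | cons i l ih => simp [MullerFormula.code, modeNumbering_val, ih]
  rw [modeFormula, key, modeCode]
  congr 1
  exact flatMap_finRange_eq_flatMap_range _ _ fun i => rfl

/-- The formula with each state replaced by the disjunction of its two copies. -/
def double {Q K : Type} (enc : Q × Bool → K) : MullerFormula Q → MullerFormula K
  | .visit q => .or (.visit (enc (q, false))) (.visit (enc (q, true)))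
  | .neg φ => .neg (double enc φ)
  | .and φ ψ => .and (double enc φ) (double enc ψ)
  | .or φ ψ => .or (double enc φ) (double enc ψ)

theorem holds_double {Q K : Type} (enc : Q × Bool → K) (φ : MullerFormula Q) (F : Set K) :
    (double enc φ).Holds F ↔ φ.Holds {q | ∃ μ, enc (q, μ) ∈ F} := by
  induction φ with
  | visit q => simp [double, MullerFormula.Holds]
  | neg φ h => simp [double, MullerFormula.Holds, h]
  | and φ ψ h1 h2 | or φ ψ h1 h2 => simp [double, MullerFormula.Holds, h1, h2]

theorem code_double {Q : Type} {k : ℕ} (eQ : Q ≃ Fin k) (φ : MullerFormula Q) :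
    (double (modeNumbering eQ) φ).code Fin.val =
      (φ.code fun q => (eQ q : ℕ)).flatMap doubleSymbol := by
  induction φ with
  | visit q => simp [double, MullerFormula.code, modeNumbering_val, doubleSymbol]
  | neg φ h => simp [double, MullerFormula.code, h, doubleSymbol]
  | and φ ψ h1 h2 | or φ ψ h1 h2 => simp [double, MullerFormula.code, h1, h2, doubleSymbol]

/-- The Muller formula of the automaton for the category quantifier. -/
def categoryFormula {Q : Type} {k : ℕ} (eQ : Q ≃ Fin k) (q₀ : Q) (φ : MullerFormula Q) :
    MullerFormula (Fin (k * 2)) :=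
  .and (modeFormula eQ q₀ false)
    (.or (.neg (modeFormula eQ q₀ true)) (double (modeNumbering eQ) φ))

section Correctness

variable {S G Q : Type} {n m k : ℕ}

theorem categoryFormula_presents (A : AltAutomaton (S × G) Q) (eQ : Q ≃ Fin k) (gs : List G)
    (g₀ : G) {φ : MullerFormula Q} (hφ : φ.Presents A.muller) :
    (categoryFormula eQ A.init φ).Presents
      (A.categoryAutomaton (modeNumbering eQ) gs g₀).muller := by
  intro F
  simp only [categoryFormula, MullerFormula.Holds, holds_modeFormula, holds_double,
    AltAutomaton.categoryAutomaton, Set.mem_ofPred_eq, hφ _, imp_iff_not_or]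

theorem code_trans (A : AltAutomaton (S × G) Q) (eS : S ≃ Fin n) (eG : G ≃ Fin m)
    (eQ : Q ≃ Fin k) (φ : MullerFormula Q) (hm : 0 < m) (x : Fin (k * 2)) (a : Fin n) :
    ((A.categoryAutomaton (modeNumbering eQ) ((List.finRange m).map eG.symm)
      (eG.symm ⟨0, hm⟩)).trans x (eS.symm a)).code Fin.val =
    transCode m (A.code ((eS.prodCongr eG).trans finProdFinEquiv) eQ φ).2.2.1 x a := by
  obtain ⟨⟨q, μ⟩, rfl⟩ := (modeNumbering eQ).surjective x
  have hentry : ∀ b : Fin m, entry (A.code ((eS.prodCongr eG).trans finProdFinEquiv) eQ φ).2.2.1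
      (eQ q) (b + m * a) = (A.trans q (eS.symm a, eG.symm b)).code fun q => (eQ q : ℕ) := by
    intro b
    have := entry_table (fun i c => (A.trans (eQ.symm i)
      (((eS.prodCongr eG).trans finProdFinEquiv).symm c)).code fun q => (eQ q : ℕ)) (eQ q)
      (finProdFinEquiv (a, b))
    simpa [AltAutomaton.code] using this
  have hbodd : (modeNumbering eQ (q, μ) : ℕ).bodd = μ := by
    rw [modeNumbering_val]
    cases μ <;> simp
  have hdiv : (modeNumbering eQ (q, μ) : ℕ).div2 = eQ q := by
    rw [modeNumbering_val, Nat.div2_val]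
    cases μ
    · simp
    · simp
      omega
  simp only [AltAutomaton.categoryAutomaton, Equiv.symm_apply_apply, code_pick, transCode, hbodd,
    hdiv]
  congr 1
  · rw [List.flatMap_map, List.flatMap_assoc]
    refine flatMap_finRange_eq_flatMap_range _ _ fun b => ?_
    rw [hentry]
    simp [code_map]
  · have := hentry ⟨0, hm⟩
    simp only [zero_add] at this
    rw [this]
    simp [code_map]

theorem construct_code (A : AltAutomaton (S × G) Q) (eS : S ≃ Fin n) (eG : G ≃ Fin m)
    (eQ : Q ≃ Fin k) (φ : MullerFormula Q) (hm : 0 < m) :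
    construct ((n, m), A.code ((eS.prodCongr eG).trans finProdFinEquiv) eQ φ) =
      (A.categoryAutomaton (modeNumbering eQ) ((List.finRange m).map eG.symm)
        (eG.symm ⟨0, hm⟩)).code eS (Equiv.refl (Fin (k * 2))) (categoryFormula eQ A.init φ) := by
  refine Prod.ext rfl (Prod.ext ?_ (Prod.ext ?_ ?_))
  · simp [construct, AltAutomaton.code, AltAutomaton.categoryAutomaton, modeNumbering_val]
  · refine (map_finRange_eq_map_range _ _ fun x => ?_).symm
    exact map_finRange_eq_map_range _ _ fun a => code_trans A eS eG eQ φ hm x a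
  · change _ = (categoryFormula eQ A.init φ).code Fin.val
    simp only [categoryFormula, MullerFormula.code, code_modeFormula, code_double]
    rfl

theorem length_code_trans {A : AltAutomaton S Q} (hA : A.IsGame) (num : Q → ℕ) (q : Q) (a : S) :
    ((A.trans q a).code num).length = 3 := by
  obtain ⟨qL, qR, h | h⟩ := hA q a <;> simp [h, PosExpr.code]

theorem graphSize_code_of_length {S Q : Type} {n k c : ℕ} {A : AltAutomaton S Q} (eS : S ≃ Fin n)
    (eQ : Q ≃ Fin k) (φ : MullerFormula Q)
    (h : ∀ q a, ((A.trans q a).code fun q => (eQ q : ℕ)).length = c) :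
    AutomatonCode.graphSize (A.code eS eQ φ) = k + k * (n * c) := by
  simp [AutomatonCode.graphSize, AltAutomaton.code, Function.comp_def, h]

theorem length_code_categoryAutomaton {A : AltAutomaton (S × G) Q} (hA : A.IsGame)
    (eG : G ≃ Fin m) (eQ : Q ≃ Fin k) (hm : 0 < m) (x : Fin (k * 2)) (a : S) :
    (((A.categoryAutomaton (modeNumbering eQ) ((List.finRange m).map eG.symm)
      (eG.symm ⟨0, hm⟩)).trans x a).code Fin.val).length = m * 8 + 3 := by
  simp only [AltAutomaton.categoryAutomaton, code_pick, List.flatMap_assoc]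
  simp [code_map, length_code_trans hA, List.length_flatMap, Function.comp_def]

theorem length_modeCode (k i μ : ℕ) : (modeCode k i μ).length = 2 * k + 1 := by
  simp [modeCode, List.length_flatMap, mul_comm]

theorem length_flatMap_doubleSymbol_le (l : List MullerFormula.Symbol) :
    (l.flatMap doubleSymbol).length ≤ 3 * l.length := by
  induction l with
  | nil => simp
  | cons s l ih =>
    have : (doubleSymbol s).length ≤ 3 := by cases s <;> simp [doubleSymbol]
    simp only [List.flatMap_cons, List.length_append, List.length_cons]
    omega

end Correctness

end CategoryCode

theorem mainTheorem2 :
    -- the language is regular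
    (∀ (S G Q : Type) [Finite S] [Finite G] [Finite Q] [Nonempty S] [Nonempty G]
      (A : AltAutomaton (S × G) Q), A.IsGame →
        IsRegularTreeLanguage (categoryQuantifier A.language)) ∧
    -- an automaton of polynomial size for it can be computed
    ∃ (construct : (ℕ × ℕ) × AutomatonCode → AutomatonCode) (p : Polynomial ℕ),
      Computable construct ∧
      ∀ (S G Q : Type) (n m k : ℕ) (eS : S ≃ Fin n) (eG : G ≃ Fin m) (eQ : Q ≃ Fin k)
        [Nonempty S] [Nonempty G]
        (A : AltAutomaton (S × G) Q) (φ : MullerFormula Q), A.IsGame → φ.Presents A.muller →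
        ∃ (k' : ℕ) (B : AltAutomaton S (Fin k')) (ψ : MullerFormula (Fin k')),
          ψ.Presents B.muller ∧
          construct ((n, m), A.code ((eS.prodCongr eG).trans finProdFinEquiv) eQ φ) =
            B.code eS (Equiv.refl (Fin k')) ψ ∧
          B.language = categoryQuantifier A.language ∧
          AutomatonCode.graphSize (B.code eS (Equiv.refl (Fin k')) ψ) ≤
            p.eval (AutomatonCode.graphSize
              (A.code ((eS.prodCongr eG).trans finProdFinEquiv) eQ φ)) ∧
          AutomatonCode.size (B.code eS (Equiv.refl (Fin k')) ψ) ≤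
            p.eval (AutomatonCode.size
              (A.code ((eS.prodCongr eG).trans finProdFinEquiv) eQ φ)) := by
  refine ⟨?_, CategoryCode.construct, 11 * Polynomial.X, CategoryCode.computable_construct, ?_⟩
  · intro S G Q _ _ _ _ _ A hA
    have : Fintype G := Fintype.ofFinite G
    rw [← A.language_categoryAutomaton (enc := Equiv.refl _) (gs := Finset.univ.toList)
      (g₀ := Classical.arbitrary G) hA fun g => Finset.mem_toList.2 (Finset.mem_univ g)]
    exact AltAutomaton.isRegular_language _
  · intro S G Q n m k eS eG eQ _ _ A φ hA hφ
    have : Finite G := Finite.of_equiv _ eG.symm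
    have : Finite Q := Finite.of_equiv _ eQ.symm
    have hm : 0 < m := Fin.pos (eG (Classical.arbitrary G))
    have hk : 0 < k := Fin.pos (eQ A.init)
    have hsize : ∀ c : AutomatonCode, AutomatonCode.size c =
      AutomatonCode.graphSize c + c.2.2.2.length := fun _ => rfl
    have hgraphA := CategoryCode.graphSize_code_of_length (A := A)
      ((eS.prodCongr eG).trans finProdFinEquiv) eQ φ
      fun q a => CategoryCode.length_code_trans hA _ q a
    have hgraphB := CategoryCode.graphSize_code_of_length (c := m * 8 + 3) eS
      (Equiv.refl (Fin (k * 2))) (CategoryCode.categoryFormula eQ A.init φ)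
      (CategoryCode.length_code_categoryAutomaton hA eG eQ hm)
    have hcode := CategoryCode.construct_code A eS eG eQ φ hm
    have hgraph : k * 2 + k * 2 * (n * (m * 8 + 3)) ≤ 2 * k + 22 * (k * (n * m)) := by
      -- the constant part `3` of each transition is absorbed, as there is at least one letter
      have : k * n ≤ k * n * m := Nat.le_mul_of_pos_right _ hm
      nlinarith
    refine ⟨k * 2, _, _, CategoryCode.categoryFormula_presents A eQ _ _ hφ, hcode,
      A.language_categoryAutomaton hA fun g => List.mem_map.2
        ⟨eG g, List.mem_finRange _, eG.symm_apply_apply g⟩, ?_, ?_⟩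
    · rw [hgraphA, hgraphB]
      simp only [Polynomial.eval_mul, Polynomial.eval_X, Polynomial.eval_ofNat]
      linarith
    · have hlen := CategoryCode.length_flatMap_doubleSymbol_le (φ.code fun q => (eQ q : ℕ))
      have hB : ((A.categoryAutomaton (CategoryCode.modeNumbering eQ)
          ((List.finRange m).map eG.symm) (eG.symm ⟨0, hm⟩)).code eS (Equiv.refl (Fin (k * 2)))
          (CategoryCode.categoryFormula eQ A.init φ)).2.2.2.length =
          4 * k + 5 + ((φ.code fun q => (eQ q : ℕ)).flatMap CategoryCode.doubleSymbol).length := by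
        rw [← hcode]
        simp only [CategoryCode.construct, List.length_cons, List.length_append,
          CategoryCode.length_modeCode, AltAutomaton.code]
        omega
      have hA' : (A.code ((eS.prodCongr eG).trans finProdFinEquiv) eQ φ).2.2.2.length =
          (φ.code fun q => (eQ q : ℕ)).length := rfl
      have h0 : 0 ≤ k * (n * m) := Nat.zero_le _
      have h1 : 0 ≤ (φ.code fun q => (eQ q : ℕ)).length := Nat.zero_le _
      rw [hsize, hsize, hgraphA, hgraphB, hB, hA']
      simp only [Polynomial.eval_mul, Polynomial.eval_X, Polynomial.eval_ofNat]
      linarith
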